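/- Let $n\in\mathbb N$, $q\in\mathbb C\setminus\{0\}$ and $r\in(0,+\infty]$. For a multi-index $k\in\mathbb Z_+^n$ put $|k|=k_1+\cdots+k_n$ and $x^k=x_1^{k_1}\cdots x_n^{k_n}$. Let $w_q(k)=1$ if $|q|\ge 1$ and $w_q(k)=|q|^{\sum_{i<j}k_ik_j}$ if $|q|<1$. For $p>0$ and $m\in\mathbb Z_+$ let $[m]_p=1+p+\cdots+p^{m-1}$, $[m]_p!=[1]_p[2]_p\cdots[m]_p$ (so $[0]_p!=1$), and let $[k]_p!=[k_1]_p!\cdots[k_n]_p!$ for $k\in\mathbb Z_+^n$. The quantum polydisk algebra is $$\mathcal O_q(\mathbb D^n_r)=\Bigl\{a=\sum_{k\in\mathbb Z_+^n}c_kx^k \;:\; \|a\|_\rho=\sum_{k}|c_k|\,w_q(k)\,\rho^{|k|}<\infty\ \ \forall\rho\in(0,r)\Bigr\},$$ and the quantum ball algebra is $$\mathcal O_q(\mathbb B^n_r)=\Bigl\{a=\sum_{k\in\mathbb Z_+^n}c_kx^k \;:\; \|a\|_\rho=\sum_{k}|c_k|\Bigl(\frac{[k]_{|q|^{-2}}!}{[\,|k|\,]_{|q|^{-2}}!}\Bigr)^{1/2}\rho^{|k|}<\infty\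 \ \forall\rho\in(0,r)\Bigr\},$$ where the $c_k$ are complex numbers. Each is given the topology determined by its own norms $\|\cdot\|_\rho$, $0<\rho<r$, and the multiplication determined by $x_ix_j=q\,x_jx_i$ for $i<j$, that is, by $x^kx^l=q^{-\sum_{i<j}k_jl_i}x^{k+l}$; both are unital topological algebras over $\mathbb C$. A topological isomorphism means a unital $\mathbb C$-algebra isomorphism that is a homeomorphism. (i) If $n\ge 2$, $r<\infty$ and $|q|=1$, then $\mathcal O_q(\mathbb D^n_r)$ and $\mathcal O_q(\mathbb B^n_r)$ are not topologically isomorphic. (ii) If $|q|\ne 1$, then $\mathcal O_q(\mathbb D^n_r)$ and $\mathcal O_q(\mathbb B^n_r)$ are topologically isomorphic; in fact they are equal as power series algebras: they consist of the same formal series, and the identity map $\sum_k c_kx^k\mapsto\sum_k c_kx^k$ is a topological isomorphism between them. -/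

import Mathlib

open scoped ENNReal

noncomputable section

/-! ### Formal power series in `q`-commuting variables -/

/-- The exponent `∑_{i<j} l_i k_j`: reordering `x^k x^l` into `x^(k+l)` moves each of the `l_i`
letters `x_i` past each of the `k_j` letters `x_j` for all `i < j`, and every such move costs a
factor `q⁻¹` by the relation `x_i x_j = q x_j x_i`. -/
def qCross {n : ℕ} (k l : Fin n →₀ ℕ) : ℕ :=
  ∑ i, ∑ j ∈ Finset.Ioi i, l i * k j

theorem qCross_add_left {n : ℕ} (k k' l : Fin n →₀ ℕ) :
    qCross (k + k') l = qCross k l + qCross k' l := by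
  simp [qCross, mul_add, Finset.sum_add_distrib]

theorem qCross_add_right {n : ℕ} (k l l' : Fin n →₀ ℕ) :
    qCross k (l + l') = qCross k l + qCross k l' := by
  simp [qCross, add_mul, Finset.sum_add_distrib]

@[simp] theorem qCross_zero_left {n : ℕ} (l : Fin n →₀ ℕ) : qCross 0 l = 0 := by
  simp [qCross]

@[simp] theorem qCross_zero_right {n : ℕ} (k : Fin n →₀ ℕ) : qCross k 0 = 0 := by
  simp [qCross]

/-- Formal power series `∑_k c_k x^k` (`k ∈ ℤ₊ⁿ`, `x^k = x_1^{k_1} ⋯ x_n^{k_n}`) with complex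
coefficients in variables subject to `x_i x_j = q x_j x_i` for `i < j`; a series is its family
of coefficients. -/
def QSeries (_q : ℂˣ) (n : ℕ) : Type := (Fin n →₀ ℕ) → ℂ

namespace QSeries

variable {q : ℂˣ} {n : ℕ}

/-- The coefficient `c_k` of `x^k`. -/
def coeff (k : Fin n →₀ ℕ) (a : QSeries q n) : ℂ := a k

/-- The series with given coefficients. -/
def mk (c : (Fin n →₀ ℕ) → ℂ) : QSeries q n := c

@[simp] theorem coeff_mk (c : (Fin n →₀ ℕ) → ℂ) (k : Fin n →₀ ℕ) :
    coeff k (mk c : QSeries q n) = c k := rfl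

@[ext] theorem ext {a b : QSeries q n} (h : ∀ k, coeff k a = coeff k b) : a = b := funext h

instance : AddCommGroup (QSeries q n) := inferInstanceAs (AddCommGroup ((Fin n →₀ ℕ) → ℂ))

instance : Module ℂ (QSeries q n) := inferInstanceAs (Module ℂ ((Fin n →₀ ℕ) → ℂ))

@[simp] theorem coeff_zero (k : Fin n →₀ ℕ) : coeff k (0 : QSeries q n) = 0 := rfl

@[simp] theorem coeff_add (k : Fin n →₀ ℕ) (a b : QSeries q n) :
    coeff k (a + b) = coeff k a + coeff k b := rfl

@[simp] theorem coeff_smul (k : Fin n →₀ ℕ) (z : ℂ) (a : QSeries q n) :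
    coeff k (z • a) = z * coeff k a := rfl

/-- Multiplication: the bilinear, coefficientwise finite extension of
`x^k x^l = q^{-∑_{i<j} l_i k_j} x^{k+l}`. -/
instance : Mul (QSeries q n) :=
  ⟨fun a b => mk fun m => ∑ p ∈ Finset.HasAntidiagonal.antidiagonal m,
    ((q⁻¹ : ℂˣ) : ℂ) ^ qCross p.1 p.2 * (coeff p.1 a * coeff p.2 b)⟩

instance : One (QSeries q n) := ⟨mk fun k => if k = 0 then 1 else 0⟩

theorem coeff_mul (m : Fin n →₀ ℕ) (a b : QSeries q n) :
    coeff m (a * b) = ∑ p ∈ Finset.HasAntidiagonal.antidiagonal m,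
      ((q⁻¹ : ℂˣ) : ℂ) ^ qCross p.1 p.2 * (coeff p.1 a * coeff p.2 b) := rfl

theorem coeff_one (k : Fin n →₀ ℕ) : coeff k (1 : QSeries q n) = if k = 0 then 1 else 0 := rfl

protected theorem one_mul (a : QSeries q n) : 1 * a = a := by
  ext m
  rw [coeff_mul, Finset.sum_eq_single (0, m)]
  · simp [coeff_one]
  · rintro ⟨k, l⟩ h hne
    have hk : k ≠ 0 := by
      rintro rfl
      simp at h
      exact hne (by simp [h])
    simp [coeff_one, hk]
  · simp

protected theorem mul_one (a : QSeries q n) : a * 1 = a := by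
  ext m
  rw [coeff_mul, Finset.sum_eq_single (m, 0)]
  · simp [coeff_one]
  · rintro ⟨k, l⟩ h hne
    have hk : l ≠ 0 := by
      rintro rfl
      simp at h
      exact hne (by simp [h])
    simp [coeff_one, hk]
  · simp

protected theorem mul_assoc (a b c : QSeries q n) : a * b * c = a * (b * c) := by
  ext m
  simp only [coeff_mul, Finset.sum_mul, Finset.mul_sum, Finset.sum_sigma']
  apply Finset.sum_nbij' (fun ⟨⟨_i, j⟩, ⟨k, l⟩⟩ ↦ ⟨(k, l + j), (l, j)⟩)
    (fun ⟨⟨i, _j⟩, ⟨k, l⟩⟩ ↦ ⟨(i + k, l), (i, k)⟩)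
  · rintro ⟨⟨i, j⟩, ⟨k, l⟩⟩ h
    simp only [Finset.mem_sigma, Finset.HasAntidiagonal.mem_antidiagonal] at h ⊢
    obtain ⟨h1, h2⟩ := h
    exact ⟨by rw [← h1, ← h2, add_assoc], trivial⟩
  · rintro ⟨⟨i, j⟩, ⟨k, l⟩⟩ h
    simp only [Finset.mem_sigma, Finset.HasAntidiagonal.mem_antidiagonal] at h ⊢
    obtain ⟨h1, h2⟩ := h
    exact ⟨by rw [← h1, ← h2, add_assoc], trivial⟩
  · rintro ⟨⟨i, j⟩, ⟨k, l⟩⟩ h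
    simp only [Finset.mem_sigma, Finset.HasAntidiagonal.mem_antidiagonal] at h
    obtain ⟨h1, rfl⟩ := h
    rfl
  · rintro ⟨⟨i, j⟩, ⟨k, l⟩⟩ h
    simp only [Finset.mem_sigma, Finset.HasAntidiagonal.mem_antidiagonal] at h
    obtain ⟨h1, rfl⟩ := h
    rfl
  · rintro ⟨⟨i, j⟩, ⟨k, l⟩⟩ h
    simp only [Finset.mem_sigma, Finset.HasAntidiagonal.mem_antidiagonal] at h
    obtain ⟨h1, rfl⟩ := h
    simp only [qCross_add_left, qCross_add_right, pow_add]
    ring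

instance : Ring (QSeries q n) :=
  { (inferInstance : AddCommGroup (QSeries q n)), (inferInstance : Mul (QSeries q n)),
    (inferInstance : One (QSeries q n)) with
    one_mul := QSeries.one_mul
    mul_one := QSeries.mul_one
    mul_assoc := QSeries.mul_assoc
    zero_mul := fun a => by ext m; simp [coeff_mul]
    mul_zero := fun a => by ext m; simp [coeff_mul]
    left_distrib := fun a b c => by
      ext m; simp [coeff_mul, mul_add, Finset.sum_add_distrib]
    right_distrib := fun a b c => by
      ext m; simp [coeff_mul, mul_add, add_mul, Finset.sum_add_distrib] }

instance : Algebra ℂ (QSeries q n) :=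
  Algebra.ofModule
    (fun z a b => by
      ext m
      simp only [coeff_mul, coeff_smul, Finset.mul_sum]
      exact Finset.sum_congr rfl fun p _ => by ring)
    (fun z a b => by
      ext m
      simp only [coeff_mul, coeff_smul, Finset.mul_sum]
      exact Finset.sum_congr rfl fun p _ => by ring)

/-- The monomial `x^k`. -/
def monomial (k : Fin n →₀ ℕ) : QSeries q n := mk fun m => if m = k then 1 else 0

/-- The canonical generator `x_i`. -/
def X (i : Fin n) : QSeries q n := monomial (Finsupp.single i 1)

theorem monomial_mul_monomial (k l : Fin n →₀ ℕ) :
    (monomial k * monomial l : QSeries q n) =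
      ((q⁻¹ : ℂˣ) : ℂ) ^ qCross k l • monomial (k + l) := by
  ext m
  simp only [coeff_mul, coeff_smul, monomial, coeff_mk]
  by_cases hm : m = k + l
  · subst hm
    rw [Finset.sum_eq_single (k, l)]
    · simp
    · rintro ⟨k', l'⟩ _ hne
      by_cases h1 : k' = k
      · have h2 : l' ≠ l := fun h2 => hne (by rw [h1, h2])
        simp [h2]
      · simp [h1]
    · simp
  · rw [if_neg hm, mul_zero]
    refine Finset.sum_eq_zero ?_
    rintro ⟨k', l'⟩ h
    rw [Finset.HasAntidiagonal.mem_antidiagonal] at h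
    by_cases h1 : k' = k
    · have h2 : l' ≠ l := by
        rintro rfl
        exact hm (by rw [← h, h1])
      simp [h2]
    · simp [h1]

/-- The defining relations `x_i x_j = q x_j x_i` for `i < j`. -/
theorem X_mul_X {i j : Fin n} (h : i < j) :
    (X i * X j : QSeries q n) = (q : ℂ) • (X j * X i) := by
  have hc : ∀ s t : Fin n,
      qCross (Finsupp.single s 1) (Finsupp.single t 1) = if t < s then 1 else 0 := by
    intro s t
    unfold qCross
    rw [Finset.sum_eq_single t]
    · simp [Finsupp.single_apply]
    · intro b _ hb
      simp [Finsupp.single_apply, hb.symm]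
    · simp
  simp only [X, monomial_mul_monomial, hc, if_pos h, if_neg h.not_gt, smul_smul]
  simp [add_comm]

/-- The monomials are the ordered products: `x^k = x_1^{k_1} ⋯ x_i^{k_i}` times `x_i` is
`x^{k + e_i}`. -/
theorem monomial_mul_X {k : Fin n →₀ ℕ} {i : Fin n} (h : ∀ j, i < j → k j = 0) :
    (monomial k * X i : QSeries q n) = monomial (k + Finsupp.single i 1) := by
  have hc : qCross k (Finsupp.single i 1) = 0 := by
    unfold qCross
    refine Finset.sum_eq_zero fun a _ => Finset.sum_eq_zero fun b hb => ?_
    by_cases ha : i = a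
    · subst ha
      rw [h b (Finset.mem_Ioi.1 hb), mul_zero]
    · simp [ha]
  rw [X, monomial_mul_monomial, hc, pow_zero, one_smul]

end QSeries

/-! ### Weighted power series algebras -/

/-- A weight on multi-indices for which every norm `∑ |c_k| w(k) ρ^|k|` is submultiplicative with
respect to the `q`-commuting product, so that the series of finite norm form an algebra. -/
structure QWeight (q : ℂˣ) (n : ℕ) where
  /-- the weight of `x^k` -/
  toFun : (Fin n →₀ ℕ) → ℝ
  nonneg : ∀ k, 0 ≤ toFun k
  submul : ∀ k l, ‖((q⁻¹ : ℂˣ) : ℂ)‖ ^ qCross k l * toFun (k + l) ≤ toFun k * toFun l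

namespace QWeight

variable {q : ℂˣ} {n : ℕ}

/-- The summand `|c_k| w(k) ρ^|k|`. -/
def term (w : QWeight q n) (ρ : ℝ) (a : QSeries q n) (k : Fin n →₀ ℕ) : ℝ :=
  ‖a.coeff k‖ * w.toFun k * ρ ^ k.degree

theorem term_nonneg (w : QWeight q n) {ρ : ℝ} (hρ : 0 ≤ ρ) (a : QSeries q n)
    (k : Fin n →₀ ℕ) : 0 ≤ w.term ρ a k :=
  mul_nonneg (mul_nonneg (norm_nonneg _) (w.nonneg k)) (pow_nonneg hρ _)

theorem term_add_le (w : QWeight q n) {ρ : ℝ} (hρ : 0 ≤ ρ) (a b : QSeries q n)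
    (k : Fin n →₀ ℕ) : w.term ρ (a + b) k ≤ w.term ρ a k + w.term ρ b k := by
  unfold term
  rw [← add_mul, ← add_mul]
  have h := norm_add_le (a.coeff k) (b.coeff k)
  have h1 := w.nonneg k
  rw [QSeries.coeff_add]
  gcongr

theorem term_smul (w : QWeight q n) (ρ : ℝ) (z : ℂ) (a : QSeries q n)
    (k : Fin n →₀ ℕ) : w.term ρ (z • a) k = ‖z‖ * w.term ρ a k := by
  simp [term, mul_assoc]

theorem term_mul_le (w : QWeight q n) {ρ : ℝ} (hρ : 0 ≤ ρ) (a b : QSeries q n)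
    (m : Fin n →₀ ℕ) : w.term ρ (a * b) m ≤
      ∑ p ∈ Finset.HasAntidiagonal.antidiagonal m, w.term ρ a p.1 * w.term ρ b p.2 := by
  unfold term
  have h1 := w.nonneg m
  calc ‖(a * b).coeff m‖ * w.toFun m * ρ ^ m.degree
      ≤ (∑ p ∈ Finset.HasAntidiagonal.antidiagonal m, ‖((q⁻¹ : ℂˣ) : ℂ)‖ ^ qCross p.1 p.2 *
          (‖a.coeff p.1‖ * ‖b.coeff p.2‖)) * w.toFun m * ρ ^ m.degree := by
        gcongr
        rw [QSeries.coeff_mul]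
        refine (norm_sum_le _ _).trans (le_of_eq ?_)
        simp only [norm_mul, norm_pow]
    _ ≤ _ := by
        rw [Finset.sum_mul, Finset.sum_mul]
        refine Finset.sum_le_sum fun p hp => ?_
        rw [Finset.HasAntidiagonal.mem_antidiagonal] at hp
        subst hp
        have h2 := mul_le_mul_of_nonneg_left (w.submul p.1 p.2)
          (mul_nonneg (mul_nonneg (norm_nonneg (a.coeff p.1)) (norm_nonneg (b.coeff p.2)))
            (mul_nonneg (pow_nonneg hρ p.1.degree) (pow_nonneg hρ p.2.degree)))
        rw [map_add, pow_add]
        linarith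

/-- The algebra of all series `∑ c_k x^k` with `∑ |c_k| w(k) ρ^|k| < ∞` for all `ρ ∈ (0, r)`. -/
def holAlg (w : QWeight q n) (r : ℝ≥0∞) : Subalgebra ℂ (QSeries q n) where
  carrier := {a | ∀ ρ : ℝ, 0 < ρ → ENNReal.ofReal ρ < r → Summable (w.term ρ a)}
  mul_mem' := by
    intro a b ha hb ρ h0 hr
    have h := summable_sum_mul_antidiagonal_of_summable_mul
      ((ha ρ h0 hr).mul_of_nonneg (hb ρ h0 hr)
        (fun k => w.term_nonneg h0.le a k) (fun k => w.term_nonneg h0.le b k))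
    exact h.of_nonneg_of_le (fun m => w.term_nonneg h0.le _ m)
      (fun m => w.term_mul_le h0.le a b m)
  add_mem' := by
    intro a b ha hb ρ h0 hr
    exact ((ha ρ h0 hr).add (hb ρ h0 hr)).of_nonneg_of_le
      (fun m => w.term_nonneg h0.le _ m) (fun m => w.term_add_le h0.le a b m)
  algebraMap_mem' := by
    intro z ρ h0 hr
    refine summable_of_hasFiniteSupport ((Set.finite_singleton (0 : Fin n →₀ ℕ)).subset ?_)
    intro k hk
    by_contra hne
    apply hk
    have hk0 : ¬ k = 0 := hne
    simp [Algebra.algebraMap_eq_smul_one, term, QSeries.coeff_one, hk0]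

/-- The norm `‖a‖_ρ = ∑ |c_k| w(k) ρ^|k|`, for `ρ ∈ (0, r)`. -/
def holNorm (w : QWeight q n) (r : ℝ≥0∞) (ρ : {ρ : ℝ // 0 < ρ ∧ ENNReal.ofReal ρ < r}) :
    Seminorm ℂ (w.holAlg r) :=
  Seminorm.of (fun a => ∑' k, w.term ρ.1 (a : QSeries q n) k)
    (fun a b => by
      have ha := a.2 ρ.1 ρ.2.1 ρ.2.2
      have hb := b.2 ρ.1 ρ.2.1 ρ.2.2
      rw [← ha.tsum_add hb]
      exact ((a + b).2 ρ.1 ρ.2.1 ρ.2.2).tsum_le_tsum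
        (fun k => w.term_add_le ρ.2.1.le _ _ k) (ha.add hb))
    (fun z a => by
      rw [← tsum_mul_left]
      exact tsum_congr fun k => w.term_smul _ _ _ _)

/-- The topology determined by the norms `‖·‖_ρ`, `ρ ∈ (0, r)`. -/
instance (w : QWeight q n) (r : ℝ≥0∞) : TopologicalSpace (w.holAlg r) :=
  ⨅ ρ, (w.holNorm r ρ).toSeminormedAddCommGroup.toUniformSpace.toTopologicalSpace

end QWeight

/-! ### The quantum polydisk -/

/-- The weight `w_q(k)`: `1` if `|q| ≥ 1` and `|q|^{∑_{i<j} k_i k_j}` if `|q| < 1`. -/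
def polydiskWeight (q : ℂˣ) (n : ℕ) : QWeight q n where
  toFun k := if 1 ≤ ‖(q : ℂ)‖ then 1 else ‖(q : ℂ)‖ ^ (∑ i, ∑ j ∈ Finset.Ioi i, k i * k j)
  nonneg k := by split_ifs <;> positivity
  submul k l := by
    have h0 : 0 < ‖(q : ℂ)‖ := norm_pos_iff.2 q.ne_zero
    rw [Units.val_inv_eq_inv_val, norm_inv]
    split_ifs with h
    · simpa using pow_le_one₀ (inv_nonneg.2 h0.le) (inv_le_one_of_one_le₀ h)
    · have e : ∀ m : Fin n →₀ ℕ, (∑ i, ∑ j ∈ Finset.Ioi i, m i * m j) = qCross m m :=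
        fun m => rfl
      rw [e, e, e, qCross_add_left, qCross_add_right, qCross_add_right, inv_pow]
      have h1 : ‖(q : ℂ)‖ ^ qCross l k ≤ 1 := pow_le_one₀ h0.le (not_le.1 h).le
      have h2 : (‖(q : ℂ)‖ ^ qCross k l)⁻¹ * ‖(q : ℂ)‖ ^ (qCross k k + qCross k l +
          (qCross l k + qCross l l)) =
          ‖(q : ℂ)‖ ^ qCross k k * ‖(q : ℂ)‖ ^ qCross l l * ‖(q : ℂ)‖ ^ qCross l k := by
        have := (pow_pos h0 (qCross k l)).ne'
        simp only [pow_add]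
        field_simp
      rw [h2]
      exact mul_le_of_le_one_right (by positivity) h1

/-- The algebra `𝒪_q(𝔻ⁿ_r)` of holomorphic functions on the quantum `n`-polydisk of radius
`r ∈ (0, ∞]`. -/
abbrev QPolydisk (q : ℂˣ) (n : ℕ) (r : ℝ≥0∞) : Subalgebra ℂ (QSeries q n) :=
  (polydiskWeight q n).holAlg r

/-! ### The quantum ball -/

/-- The `q`-integer `[m]_p = 1 + p + ⋯ + p^{m-1}`. -/
def qInt (p : ℝ) (m : ℕ) : ℝ := ∑ i ∈ Finset.range m, p ^ i

/-- The `q`-factorial `[m]_p! = [1]_p [2]_p ⋯ [m]_p`. -/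
def qFact (p : ℝ) (m : ℕ) : ℝ := ∏ i ∈ Finset.range m, qInt p (i + 1)

theorem qInt_succ_pos {p : ℝ} (hp : 0 < p) (m : ℕ) : 0 < qInt p (m + 1) :=
  Finset.sum_pos (fun i _ => pow_pos hp i) ⟨0, by simp⟩

theorem qFact_pos {p : ℝ} (hp : 0 < p) (m : ℕ) : 0 < qFact p m :=
  Finset.prod_pos fun i _ => qInt_succ_pos hp i

theorem qInt_add (p : ℝ) (a b : ℕ) : qInt p (a + b) = qInt p a + p ^ a * qInt p b := by
  simp [qInt, Finset.sum_range_add, Finset.mul_sum, pow_add]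

theorem qFact_succ (p : ℝ) (m : ℕ) : qFact p (m + 1) = qFact p m * qInt p (m + 1) :=
  Finset.prod_range_succ _ _

/-- The `q`-binomial coefficient `[a+b]_p! / ([a]_p! [b]_p!)`. -/
def qBin (p : ℝ) (a b : ℕ) : ℝ := qFact p (a + b) / (qFact p a * qFact p b)

theorem qBin_pos {p : ℝ} (hp : 0 < p) (a b : ℕ) : 0 < qBin p a b :=
  div_pos (qFact_pos hp _) (mul_pos (qFact_pos hp _) (qFact_pos hp _))

theorem qBin_zero_left {p : ℝ} (hp : 0 < p) (b : ℕ) : qBin p 0 b = 1 := by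
  have h0 : qFact p 0 = 1 := Finset.prod_range_zero _
  rw [qBin, h0, zero_add, one_mul, div_self (qFact_pos hp b).ne']

theorem qBin_zero_right {p : ℝ} (hp : 0 < p) (a : ℕ) : qBin p a 0 = 1 := by
  have h0 : qFact p 0 = 1 := Finset.prod_range_zero _
  rw [qBin, h0, add_zero, mul_one, div_self (qFact_pos hp a).ne']

/-- The `q`-Pascal rule. -/
theorem qBin_succ_succ {p : ℝ} (hp : 0 < p) (a b : ℕ) :
    qBin p (a + 1) (b + 1) = p ^ (b + 1) * qBin p a (b + 1) + qBin p (a + 1) b := by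
  have h1 := (qFact_pos hp a).ne'
  have h2 := (qFact_pos hp b).ne'
  have h3 := (qInt_succ_pos hp a).ne'
  have h4 := (qInt_succ_pos hp b).ne'
  have e : qInt p (a + 1 + b + 1) = qInt p (b + 1) + p ^ (b + 1) * qInt p (a + 1) := by
    rw [← qInt_add]; congr 1; ring
  have e1 : a + 1 + (b + 1) = (a + 1 + b) + 1 := by ring
  have e2 : a + (b + 1) = a + 1 + b := by ring
  unfold qBin
  rw [e1, e2, qFact_succ p (a + 1 + b), e, qFact_succ p a, qFact_succ p b]
  field_simp
  ring

theorem qBin_le_succ_left {p : ℝ} (hp : 0 < p) (a b : ℕ) :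
    p ^ b * qBin p a b ≤ qBin p (a + 1) b := by
  cases b with
  | zero => simp [qBin_zero_right hp]
  | succ b =>
    rw [qBin_succ_succ hp]
    linarith [qBin_pos hp (a + 1) b]

theorem qBin_le_succ_right {p : ℝ} (hp : 0 < p) (a b : ℕ) :
    qBin p a b ≤ qBin p a (b + 1) := by
  cases a with
  | zero => simp [qBin_zero_left hp]
  | succ a =>
    rw [qBin_succ_succ hp]
    have := mul_pos (pow_pos hp (b + 1)) (qBin_pos hp a (b + 1))
    linarith

/-- One term of the `q`-Chu–Vandermonde sum is at most the whole sum. -/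
theorem qBin_vandermonde_le {p : ℝ} (hp : 0 < p) (a b : ℕ) (c d : ℕ) :
    p ^ (b * c) * (qBin p a b * qBin p c d) ≤ qBin p (a + c) (b + d) := by
  induction c generalizing d with
  | zero =>
    induction d with
    | zero => simp [qBin_zero_left hp]
    | succ d ih =>
      simp only [qBin_zero_left hp] at ih ⊢
      exact ih.trans (qBin_le_succ_right hp _ _)
  | succ c ihc =>
    induction d with
    | zero =>
      have h := ihc 0
      simp only [qBin_zero_right hp] at h ⊢
      have h2 := qBin_le_succ_left hp (a + c) (b + 0)
      have h3 := mul_le_mul_of_nonneg_left h (pow_pos hp b).le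
      have e : p ^ (b * (c + 1)) = p ^ b * p ^ (b * c) := by ring
      rw [e]
      calc _ = p ^ b * (p ^ (b * c) * (qBin p a b * 1)) := by ring
        _ ≤ _ := h3.trans h2
    | succ d ihd =>
      have h1 := mul_le_mul_of_nonneg_left (ihc (d + 1)) (pow_pos hp (b + (d + 1))).le
      have e : qBin p (a + (c + 1)) (b + (d + 1)) =
          p ^ (b + (d + 1)) * qBin p (a + c) (b + (d + 1)) + qBin p (a + (c + 1)) (b + d) :=
        qBin_succ_succ hp (a + c) (b + d)
      rw [e, qBin_succ_succ hp c d]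
      have e2 : p ^ (b * (c + 1)) * (qBin p a b *
          (p ^ (d + 1) * qBin p c (d + 1) + qBin p (c + 1) d)) =
          p ^ (b + (d + 1)) * (p ^ (b * c) * (qBin p a b * qBin p c (d + 1))) +
          p ^ (b * (c + 1)) * (qBin p a b * qBin p (c + 1) d) := by ring
      rw [e2]
      exact add_le_add h1 ihd

theorem qBin_prod_le {p : ℝ} (hp : 0 < p) : ∀ (n : ℕ) (k l : Fin n → ℕ),
    p ^ (∑ i, ∑ j ∈ Finset.Ioi i, l i * k j) * ∏ i, qBin p (k i) (l i) ≤
      qBin p (∑ i, k i) (∑ i, l i) := by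
  intro n
  induction n with
  | zero => intro k l; simp [qBin_zero_left hp]
  | succ n ih =>
    intro k l
    have h := ih (fun i => k i.succ) (fun i => l i.succ)
    have h2 := qBin_vandermonde_le hp (k 0) (l 0) (∑ i : Fin n, k i.succ) (∑ i : Fin n, l i.succ)
    rw [Fin.sum_univ_succ, Fin.prod_univ_succ, Fin.sum_univ_succ k, Fin.sum_univ_succ l]
    refine le_trans ?_ h2
    simp only [Fin.sum_Ioi_succ, Fin.sum_Ioi_zero, ← Finset.mul_sum] at h ⊢
    have h3 := mul_le_mul_of_nonneg_left h
      (mul_pos (pow_pos hp (l 0 * ∑ i : Fin n, k i.succ)) (qBin_pos hp (k 0) (l 0))).le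
    rw [pow_add]
    linarith

/-- The weight `([k]_p! / [|k|]_p!)^{1/2}` with `p = |q|⁻²` and
`[k]_p! = [k_1]_p! ⋯ [k_n]_p!`. -/
def ballWeight (q : ℂˣ) (n : ℕ) : QWeight q n where
  toFun k := √((∏ i, qFact (‖(q : ℂ)‖ ^ (-2 : ℤ)) (k i)) /
    qFact (‖(q : ℂ)‖ ^ (-2 : ℤ)) k.degree)
  nonneg k := Real.sqrt_nonneg _
  submul k l := by
    have h0 : 0 < ‖(q : ℂ)‖ := norm_pos_iff.2 q.ne_zero
    have hp : 0 < ‖(q : ℂ)‖ ^ (-2 : ℤ) := zpow_pos h0 _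
    have hs : ‖((q⁻¹ : ℂˣ) : ℂ)‖ = √(‖(q : ℂ)‖ ^ (-2 : ℤ)) := by
      rw [Units.val_inv_eq_inv_val, norm_inv, eq_comm, Real.sqrt_eq_iff_eq_sq hp.le (by positivity)]
      rw [zpow_neg, inv_pow]
      rfl
    rw [hs]
    generalize ‖(q : ℂ)‖ ^ (-2 : ℤ) = p at hp
    have hF : ∀ m : Fin n →₀ ℕ, 0 < ∏ i, qFact p (m i) :=
      fun m => Finset.prod_pos fun i _ => qFact_pos hp _
    rw [← Real.sqrt_mul (div_pos (hF k) (qFact_pos hp _)).le]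
    have e : √p ^ qCross k l = √(p ^ qCross k l) := by
      rw [eq_comm, Real.sqrt_eq_iff_eq_sq (by positivity) (by positivity), ← pow_mul, mul_comm,
        pow_mul, Real.sq_sqrt hp.le]
    rw [e, ← Real.sqrt_mul (by positivity)]
    apply Real.sqrt_le_sqrt
    have h := qBin_prod_le hp n k l
    rw [← Finsupp.degree_eq_sum, ← Finsupp.degree_eq_sum] at h
    simp only [qBin, Finset.prod_div_distrib, Finset.prod_mul_distrib] at h
    change p ^ qCross k l * _ ≤ _ at h
    rw [map_add]
    simp only [Finsupp.add_apply]
    have hk := hF k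
    have hl := hF l
    have h1 := qFact_pos hp k.degree
    have h2 := qFact_pos hp l.degree
    have h3 := qFact_pos hp (k.degree + l.degree)
    rw [← mul_div_assoc, div_le_div_iff₀ (mul_pos hk hl) (mul_pos h1 h2)] at h
    rw [← mul_div_assoc, div_mul_div_comm, div_le_div_iff₀ h3 (mul_pos h1 h2)]
    linarith

/-- The algebra `𝒪_q(𝔹ⁿ_r)` of holomorphic functions on the quantum `n`-ball of radius
`r ∈ (0, ∞]`. -/
abbrev QBall (q : ℂˣ) (n : ℕ) (r : ℝ≥0∞) : Subalgebra ℂ (QSeries q n) :=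
  (ballWeight q n).holAlg r

end

/-! ### Continuity in terms of the norms -/

namespace QWeight

variable {q : ℂˣ} {n : ℕ}

/-! For `|q| ≠ 1` the two weights are equivalent. Put `p = |q|⁻²`. If `p < 1`, then `(1 - p)^m
[m]_p!` stays between two positive constants, so `[k]_p! / [|k|]_p!` does too, since the powers of
`1 - p` cancel. If `p > 1`, replacing `p` by `p⁻¹` in this quotient produces exactly the factor
`w_q(k)²`, and the first case applies (`exists_ballWeight_eq`).

For `|q| = 1`, `q ≠ 1`, noncommutativity makes isomorphisms rigid: comparing low-order coefficients
in the images of `x_i x_j = c x_j x_i`, `c ≠ 1`, shows that generators go to series without constant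
term whose linear part is a multiple of a single generator. A Schwarz lemma bounds these multiples
by 1 in one direction, hence below by 1 in the other. So the images of `x_i^m x_j^m` under ball →
polydisk keep leading coefficients of modulus at least 1, while the ball norm of `x_i^m x_j^m`
carries the factor `binom(2m, m)^(-1/2)`, of order `2^(-m)` up to a polynomial. For `R < ∞`
continuity cannot absorb this loss.

For `q = 1` points of the polydisk give characters, and an isomorphism induces a holomorphic
injective map `F` from the polydisk to the Euclidean ball that is proper
(`exists_norm_le_of_norm_inducedMap_le`). As one coordinate `z` tends to the circle, `F(z, 0)` tends
to the sphere; a Borel–Carathéodory estimate then forces `F(z, w) - F(z, 0) → 0`, and the maximum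
principle gives `F(0, w) = F(0, 0)`, against injectivity. -/

instance (w : QWeight q n) (r : ℝ≥0∞) : IsTopologicalAddGroup (w.holAlg r) :=
  topologicalAddGroup_iInf fun ρ =>
    (w.holNorm r ρ).toSeminormedAddCommGroup.toIsTopologicalAddGroup

theorem withSeminorms_holNorm (w : QWeight q n) (r : ℝ≥0∞) : WithSeminorms (w.holNorm r) :=
  (SeminormFamily.withSeminorms_iff_topologicalSpace_eq_iInf _).2 rfl

theorem holNorm_apply (w : QWeight q n) (r : ℝ≥0∞) (ρ : {ρ : ℝ // 0 < ρ ∧ ENNReal.ofReal ρ < r})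
    (a : w.holAlg r) : w.holNorm r ρ a = ∑' k, w.term ρ.1 (a : QSeries q n) k := rfl

theorem term_le_holNorm (w : QWeight q n) (r : ℝ≥0∞)
    (ρ : {ρ : ℝ // 0 < ρ ∧ ENNReal.ofReal ρ < r}) (a : w.holAlg r) (k : Fin n →₀ ℕ) :
    w.term ρ.1 (a : QSeries q n) k ≤ w.holNorm r ρ a :=
  (a.2 ρ.1 ρ.2.1 ρ.2.2).le_tsum k fun _ _ => w.term_nonneg ρ.2.1.le _ _

theorem holNorm_mono (w : QWeight q n) (r : ℝ≥0∞) : Monotone (w.holNorm r) := by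
  intro ρ ρ' h a
  refine (a.2 ρ.1 ρ.2.1 ρ.2.2).tsum_le_tsum (fun k => ?_) (a.2 ρ'.1 ρ'.2.1 ρ'.2.2)
  have h1 := w.nonneg k
  have h2 := ρ.2.1.le
  have h3 : (ρ : ℝ) ≤ ρ' := h
  unfold term
  gcongr

theorem nonempty_radius {r : ℝ≥0∞} (hr : 0 < r) :
    Nonempty {ρ : ℝ // 0 < ρ ∧ ENNReal.ofReal ρ < r} := by
  obtain ⟨s, hs0, hsr⟩ := exists_between hr
  have hs : s ≠ ∞ := hsr.ne_top
  exact ⟨⟨s.toReal, ENNReal.toReal_pos hs0.ne' hs, by rwa [ENNReal.ofReal_toReal hs]⟩⟩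

/-- A continuous linear map into a seminormed space is bounded for one of the norms. -/
theorem exists_bound_seminorm {w : QWeight q n} {r : ℝ≥0∞} (hr : 0 < r)
    (p : Seminorm ℂ (w.holAlg r)) (hp : Continuous p) :
    ∃ ρ, ∃ C : ℝ, 0 < C ∧ ∀ a, p a ≤ C * w.holNorm r ρ a := by
  have := nonempty_radius hr
  obtain ⟨s, C, hC, h⟩ := Seminorm.bound_of_continuous (w.withSeminorms_holNorm r) p hp
  -- The norms increase with the radius, so a finite supremum of them is dominated by a single one.
  obtain ⟨ρ, hρ⟩ := s.exists_le
  refine ⟨ρ, C, by exact_mod_cast pos_iff_ne_zero.2 hC, fun a => (h a).trans ?_⟩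
  have h1 : s.sup (w.holNorm r) a ≤ w.holNorm r ρ a :=
    (Finset.sup_le (fun i hi => w.holNorm_mono r (hρ i hi)) : s.sup (w.holNorm r) ≤ _) a
  rw [smul_apply, NNReal.smul_def, smul_eq_mul]
  gcongr

theorem exists_bound {w w' : QWeight q n} {r : ℝ≥0∞} (hr : 0 < r)
    (f : w.holAlg r →ₗ[ℂ] w'.holAlg r) (hf : Continuous f) (ρ') :
    ∃ ρ, ∃ C : ℝ, 0 < C ∧ ∀ a, w'.holNorm r ρ' (f a) ≤ C * w.holNorm r ρ a :=
  exists_bound_seminorm hr ((w'.holNorm r ρ').comp f)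
    (((w'.withSeminorms_holNorm r).continuous_seminorm ρ').comp hf)

theorem continuous_of_bound {w w' : QWeight q n} {r : ℝ≥0∞}
    (f : w.holAlg r →ₗ[ℂ] w'.holAlg r) (C : ℝ)
    (h : ∀ ρ a, w'.holNorm r ρ (f a) ≤ C * w.holNorm r ρ a) : Continuous f := by
  refine (w.withSeminorms_holNorm r).continuous_of_isBounded (w'.withSeminorms_holNorm r) f ?_
  refine fun ρ => ⟨{ρ}, C.toNNReal, fun a => (h ρ a).trans ?_⟩
  rw [smul_apply, NNReal.smul_def, smul_eq_mul, Finset.sup_singleton]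
  exact mul_le_mul_of_nonneg_right (Real.le_coe_toNNReal C) (apply_nonneg _ _)

/-! ### Monomials -/

theorem monomial_mem (w : QWeight q n) (r : ℝ≥0∞) (k : Fin n →₀ ℕ) :
    QSeries.monomial k ∈ w.holAlg r := by
  intro ρ _ _
  refine summable_of_hasFiniteSupport ((Set.finite_singleton k).subset ?_)
  intro l hl
  by_contra hne
  apply hl
  have hne : ¬ l = k := hne
  simp [term, QSeries.monomial, hne]

/-- The monomial `x^k` as an element of the algebra. -/
noncomputable def holMonomial (w : QWeight q n) (r : ℝ≥0∞) (k : Fin n →₀ ℕ) : w.holAlg r :=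
  ⟨QSeries.monomial k, w.monomial_mem r k⟩

/-- The generator `x_i` as an element of the algebra. -/
noncomputable abbrev holX (w : QWeight q n) (r : ℝ≥0∞) (i : Fin n) : w.holAlg r :=
  w.holMonomial r (Finsupp.single i 1)

@[simp] theorem coe_holMonomial (w : QWeight q n) (r : ℝ≥0∞) (k : Fin n →₀ ℕ) :
    (w.holMonomial r k : QSeries q n) = QSeries.monomial k := rfl

theorem holMonomial_zero (w : QWeight q n) (r : ℝ≥0∞) : w.holMonomial r 0 = 1 := by
  apply Subtype.ext
  ext k
  simp [QSeries.monomial, QSeries.coeff_one]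

theorem holMonomial_mul (w : QWeight q n) (r : ℝ≥0∞) (k l : Fin n →₀ ℕ) :
    w.holMonomial r k * w.holMonomial r l =
      ((q⁻¹ : ℂˣ) : ℂ) ^ qCross k l • w.holMonomial r (k + l) :=
  Subtype.ext (QSeries.monomial_mul_monomial k l)

theorem holMonomial_add (w : QWeight q n) (r : ℝ≥0∞) (k l : Fin n →₀ ℕ) :
    w.holMonomial r (k + l) = (q : ℂ) ^ qCross k l • (w.holMonomial r k * w.holMonomial r l) := by
  rw [holMonomial_mul, smul_smul, ← mul_pow]
  simp

theorem holX_mul_holX (w : QWeight q n) (r : ℝ≥0∞) {i j : Fin n} (h : i < j) :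
    w.holX r i * w.holX r j = (q : ℂ) • (w.holX r j * w.holX r i) :=
  Subtype.ext (QSeries.X_mul_X h)

theorem holNorm_holMonomial (w : QWeight q n) (r : ℝ≥0∞) (ρ) (k : Fin n →₀ ℕ) :
    w.holNorm r ρ (w.holMonomial r k) = w.toFun k * ρ.1 ^ k.degree := by
  rw [holNorm_apply, tsum_eq_single k]
  · simp [term, QSeries.monomial]
  · intro l hl
    simp [term, QSeries.monomial, hl]

/-- The monomials generate: a subalgebra containing the generators contains all of them. -/
theorem holMonomial_mem_of_holX_mem (w : QWeight q n) (r : ℝ≥0∞) (S : Subalgebra ℂ (w.holAlg r))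
    (h : ∀ i, w.holX r i ∈ S) (k : Fin n →₀ ℕ) : w.holMonomial r k ∈ S := by
  have hadd : ∀ k l, w.holMonomial r k ∈ S → w.holMonomial r l ∈ S →
      w.holMonomial r (k + l) ∈ S := by
    intro k l hk hl
    rw [holMonomial_add]
    exact S.smul_mem (S.mul_mem hk hl) _
  have h0 : w.holMonomial r 0 ∈ S := by
    rw [holMonomial_zero]
    exact S.one_mem
  refine Finsupp.induction_linear k h0 hadd fun i m => ?_
  induction m with
  | zero => simpa using h0
  | succ m ih =>
    rw [Finsupp.single_add]
    exact hadd _ _ ih (h i)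

/-! ### Continuous functionals and their values on monomials -/

/-- The coefficient functionals. -/
noncomputable def holCoeff (w : QWeight q n) (r : ℝ≥0∞) (k : Fin n →₀ ℕ) :
    w.holAlg r →ₗ[ℂ] ℂ where
  toFun a := (a : QSeries q n).coeff k
  map_add' _ _ := rfl
  map_smul' _ _ := rfl

@[simp] theorem holCoeff_apply (w : QWeight q n) (r : ℝ≥0∞) (k : Fin n →₀ ℕ) (a : w.holAlg r) :
    w.holCoeff r k a = (a : QSeries q n).coeff k := rfl

theorem continuous_of_norm_le {w : QWeight q n} {r : ℝ≥0∞} (f : w.holAlg r →ₗ[ℂ] ℂ) {ρ} {C : ℝ}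
    (h : ∀ a, ‖f a‖ ≤ C * w.holNorm r ρ a) : Continuous f := by
  refine (w.withSeminorms_holNorm r).continuous_normedSpace_rng ℂ f
    ⟨{ρ}, C.toNNReal, fun a => (h a).trans ?_⟩
  rw [smul_apply, NNReal.smul_def, smul_eq_mul, Finset.sup_singleton]
  exact mul_le_mul_of_nonneg_right (Real.le_coe_toNNReal C) (apply_nonneg _ _)

/-- A continuous functional can be computed term by term. -/
theorem hasSum_of_continuous {w : QWeight q n} {r : ℝ≥0∞} (hr : 0 < r) (f : w.holAlg r →ₗ[ℂ] ℂ)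
    (hf : Continuous f) (a : w.holAlg r) :
    HasSum (fun k => (a : QSeries q n).coeff k * f (w.holMonomial r k)) (f a) := by
  obtain ⟨ρ, C, -, h⟩ := exists_bound_seminorm hr ((normSeminorm ℂ ℂ).comp f) hf.norm
  have hs := a.2 ρ.1 ρ.2.1 ρ.2.2
  have h0 := (tendsto_tsum_compl_atTop_zero (w.term ρ.1 (a : QSeries q n))).const_mul C
  rw [mul_zero] at h0
  rw [HasSum, tendsto_iff_norm_sub_tendsto_zero]
  refine squeeze_zero (fun _ => norm_nonneg _) (fun s => ?_) h0
  -- Partial sum of `a` over `s`: the error `f (a - b)` is at most `C` times the tail of the series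
  -- defining `‖a‖_ρ`.
  let b : w.holAlg r := ∑ k ∈ s, (a : QSeries q n).coeff k • w.holMonomial r k
  have hb : f b = ∑ k ∈ s, (a : QSeries q n).coeff k * f (w.holMonomial r k) := by
    simp [b]
  have hcoeff : ∀ l, ((a - b : w.holAlg r) : QSeries q n).coeff l =
      if l ∈ s then 0 else (a : QSeries q n).coeff l := by
    intro l
    have hb' : (b : QSeries q n).coeff l = if l ∈ s then (a : QSeries q n).coeff l else 0 := by
      rw [← holCoeff_apply, map_sum]
      simp [QSeries.monomial]
    change (a : QSeries q n).coeff l - (b : QSeries q n).coeff l = _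
    rw [hb']
    split_ifs <;> simp
  rw [norm_sub_rev, ← hb, ← map_sub]
  refine (h _).trans (le_of_eq ?_)
  congr 1
  refine Eq.trans ?_ (tsum_subtype (s : Set (Fin n →₀ ℕ))ᶜ (w.term ρ.1 (a : QSeries q n))).symm
  rw [holNorm_apply]
  refine tsum_congr fun l => ?_
  rw [term, hcoeff]
  by_cases hl : l ∈ s <;> simp [term, hl]

/-- Continuity serves only to expand `f a` termwise. The radius `ρ` is prescribed and no constant is
lost, which is what the properness argument for `q = 1` needs. -/
theorem norm_le_of_norm_holMonomial_le {w : QWeight q n} {r : ℝ≥0∞} (hr : 0 < r)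
    (f : w.holAlg r →ₗ[ℂ] ℂ) (hf : Continuous f) (ρ)
    (h : ∀ k, ‖f (w.holMonomial r k)‖ ≤ w.toFun k * ρ.1 ^ k.degree) (a : w.holAlg r) :
    ‖f a‖ ≤ w.holNorm r ρ a := by
  rw [← (hasSum_of_continuous hr f hf a).tsum_eq]
  refine tsum_of_norm_bounded (a.2 ρ.1 ρ.2.1 ρ.2.2).hasSum fun k => ?_
  rw [norm_mul, term, mul_assoc]
  exact mul_le_mul_of_nonneg_left (h k) (norm_nonneg _)

theorem eq_of_eq_on_holMonomial {w : QWeight q n} {r : ℝ≥0∞} (hr : 0 < r)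
    (f g : w.holAlg r →ₗ[ℂ] ℂ) (hf : Continuous f) (hg : Continuous g)
    (h : ∀ k, f (w.holMonomial r k) = g (w.holMonomial r k)) : f = g := by
  ext a
  have h1 := hasSum_of_continuous hr f hf a
  simp only [h] at h1
  exact h1.unique (hasSum_of_continuous hr g hg a)

theorem continuous_holCoeff (w : QWeight q n) {r : ℝ≥0∞} (hr : 0 < r) {k : Fin n →₀ ℕ}
    (hk : 0 < w.toFun k) : Continuous (w.holCoeff r k) := by
  obtain ⟨ρ⟩ := nonempty_radius hr
  refine continuous_of_norm_le (ρ := ρ) (C := (w.toFun k * ρ.1 ^ k.degree)⁻¹) _ fun a => ?_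
  have h := w.term_le_holNorm r ρ a k
  have h1 : 0 < w.toFun k * ρ.1 ^ k.degree := mul_pos hk (pow_pos ρ.2.1 _)
  rw [inv_mul_eq_div, le_div_iff₀ h1, ← mul_assoc]
  exact h

end QWeight

/-! ### Equivalent weights -/

namespace QWeight

variable {q : ℂˣ} {n : ℕ}

theorem term_le_of_le {w w' : QWeight q n} {C : ℝ} (h : ∀ k, w'.toFun k ≤ C * w.toFun k) {ρ : ℝ}
    (hρ : 0 ≤ ρ) (a : QSeries q n) (k : Fin n →₀ ℕ) : w'.term ρ a k ≤ C * w.term ρ a k := by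
  have h1 := mul_le_mul_of_nonneg_left (h k) (mul_nonneg (norm_nonneg (a.coeff k))
    (pow_nonneg hρ k.degree))
  unfold term
  linarith

theorem holAlg_le_of_le {w w' : QWeight q n} {C : ℝ} (h : ∀ k, w'.toFun k ≤ C * w.toFun k)
    (r : ℝ≥0∞) : w.holAlg r ≤ w'.holAlg r := fun a ha ρ h0 hr =>
  ((ha ρ h0 hr).mul_left C).of_nonneg_of_le (fun k => w'.term_nonneg h0.le a k)
    (fun k => term_le_of_le h h0.le a k)

theorem continuous_of_weight_le {w w' : QWeight q n} {C : ℝ}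
    (h : ∀ k, w'.toFun k ≤ C * w.toFun k) {r : ℝ≥0∞} (f : w.holAlg r →ₗ[ℂ] w'.holAlg r)
    (hf : ∀ a, (f a : QSeries q n) = a) : Continuous f := by
  refine continuous_of_bound f C fun ρ a => ?_
  rw [holNorm_apply, holNorm_apply, hf, ← tsum_mul_left]
  have h1 := a.2 ρ.1 ρ.2.1 ρ.2.2
  refine Summable.tsum_le_tsum (fun k => term_le_of_le h ρ.2.1.le _ k) ?_ (h1.mul_left C)
  exact holAlg_le_of_le h r a.2 ρ.1 ρ.2.1 ρ.2.2

/-- Equivalent weights define the same algebra with the same topology. -/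
theorem exists_identity_equiv {w w' : QWeight q n} {C C' : ℝ}
    (h : ∀ k, w'.toFun k ≤ C * w.toFun k) (h' : ∀ k, w.toFun k ≤ C' * w'.toFun k) (r : ℝ≥0∞) :
    w.holAlg r = w'.holAlg r ∧ ∃ φ : w.holAlg r ≃A[ℂ] w'.holAlg r,
      ∀ a, (φ a : QSeries q n) = (a : QSeries q n) := by
  have e := le_antisymm (holAlg_le_of_le h r) (holAlg_le_of_le h' r)
  let φ := Subalgebra.equivOfEq _ _ e
  refine ⟨e, ⟨φ, ?_, ?_⟩, fun a => rfl⟩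
  · exact continuous_of_weight_le h φ.toLinearMap fun a => rfl
  · exact continuous_of_weight_le h' φ.symm.toLinearMap fun a => rfl

end QWeight

/-! ### Estimates for `q`-factorials -/

/-- The normalized factorial is the partial product `∏ (1 - p^(i+1))` of a convergent infinite
product. The lower bound comes from `log x ≥ 1 - 1/x` and the geometric series, which explains the
constant `exp (-(1 - p)⁻²)`. -/
theorem exists_pos_le_qFact {p : ℝ} (hp : 0 < p) (hp1 : p < 1) :
    ∃ c : ℝ, 0 < c ∧ ∀ m, c ≤ (1 - p) ^ m * qFact p m ∧ (1 - p) ^ m * qFact p m ≤ 1 := by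
  have h1 : 0 < 1 - p := sub_pos.2 hp1
  have e : ∀ m, (1 - p) ^ m * qFact p m = ∏ i ∈ Finset.range m, (1 - p ^ (i + 1)) := by
    intro m
    rw [qFact, ← Finset.card_range m, ← Finset.prod_const, Finset.card_range,
      ← Finset.prod_mul_distrib]
    exact Finset.prod_congr rfl fun i _ => mul_neg_geom_sum p (i + 1)
  have hle : ∀ i, p ^ (i + 1) ≤ p := fun i => by
    simpa using pow_le_pow_of_le_one hp.le hp1.le (Nat.succ_le_succ (Nat.zero_le i))
  have hpos : ∀ i, 0 < 1 - p ^ (i + 1) := fun i => by linarith [hle i]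
  refine ⟨Real.exp (-(1 - p)⁻¹ ^ 2), Real.exp_pos _, fun m => ⟨?_, ?_⟩⟩
  · rw [e, ← Real.exp_log (Finset.prod_pos fun i _ => hpos i),
      Real.log_prod (fun i _ => (hpos i).ne'), Real.exp_le_exp]
    have hterm : ∀ i ∈ Finset.range m, -((1 - p)⁻¹ * p ^ i) ≤ Real.log (1 - p ^ (i + 1)) := by
      intro i _
      refine le_trans ?_ (Real.one_sub_inv_le_log_of_pos (hpos i))
      have h2 : 1 - (1 - p ^ (i + 1))⁻¹ = -((1 - p ^ (i + 1))⁻¹ * p ^ (i + 1)) := by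
        have := (hpos i).ne'
        field_simp
        ring
      rw [h2, neg_le_neg_iff]
      have h3 : p ^ (i + 1) ≤ p ^ i := pow_le_pow_of_le_one hp.le hp1.le (Nat.le_succ i)
      have h4 : 1 - p ≤ 1 - p ^ (i + 1) := by linarith [hle i]
      gcongr
    refine le_trans ?_ (Finset.sum_le_sum hterm)
    rw [Finset.sum_neg_distrib, ← Finset.mul_sum, neg_le_neg_iff, sq]
    have h5 : ∑ i ∈ Finset.range m, p ^ i ≤ (1 - p)⁻¹ := by
      rw [← tsum_geometric_of_lt_one hp.le hp1]
      exact (summable_geometric_of_lt_one hp.le hp1).sum_le_tsum _ fun i _ => (pow_pos hp i).le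
    gcongr
  · rw [e]
    exact Finset.prod_le_one (fun i _ => (hpos i).le) fun i _ => by
      linarith [pow_pos hp (i + 1)]

theorem qInt_succ_eq_pow_mul_qInt_inv {p : ℝ} (hp : 0 < p) (m : ℕ) :
    qInt p (m + 1) = p ^ m * qInt p⁻¹ (m + 1) := by
  rw [qInt, qInt, Finset.mul_sum, ← Finset.sum_range_reflect]
  refine Finset.sum_congr rfl fun i hi => ?_
  rw [Finset.mem_range] at hi
  have e : m = (m + 1 - 1 - i) + i := by omega
  conv_rhs => rw [e, pow_add, inv_pow, mul_assoc, mul_inv_cancel₀ (pow_pos hp i).ne', mul_one]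

theorem qFact_eq_pow_mul_qFact_inv {p : ℝ} (hp : 0 < p) (m : ℕ) :
    qFact p m = p ^ (m.choose 2) * qFact p⁻¹ m := by
  induction m with
  | zero => simp [qFact]
  | succ m ih =>
    rw [qFact_succ, qFact_succ, ih, qInt_succ_eq_pow_mul_qInt_inv hp, Nat.choose_succ_succ' m 1,
      Nat.choose_one_right, pow_add]
    ring

theorem choose_two_add (a b : ℕ) : (a + b).choose 2 = a.choose 2 + b.choose 2 + a * b := by
  induction b with
  | zero => simp
  | succ b ih =>
    rw [← add_assoc, Nat.choose_succ_succ' _ 1, Nat.choose_succ_succ' b 1, ih]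
    simp only [Nat.choose_one_right, Nat.reduceAdd]
    ring

/-- Counts pairs in a disjoint union of blocks of sizes `k i`: both points in one block, or in two
different blocks. The mixed pairs give the exponent of `w_q`. -/
theorem choose_two_sum : ∀ (n : ℕ) (k : Fin n → ℕ),
    (∑ i, k i).choose 2 = ∑ i, (k i).choose 2 + ∑ i, ∑ j ∈ Finset.Ioi i, k i * k j := by
  intro n
  induction n with
  | zero => intro k; simp
  | succ n ih =>
    intro k
    rw [Fin.sum_univ_succ, choose_two_add, ih, Fin.sum_univ_succ (fun i => (k i).choose 2),
      Fin.sum_univ_succ (fun i => ∑ j ∈ Finset.Ioi i, k i * k j)]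
    simp only [Fin.sum_Ioi_succ, Fin.sum_Ioi_zero, ← Finset.mul_sum]
    ring

/-- Since `[m]_p! = p^(m choose 2) [m]_{p⁻¹}!`, only the difference between `|k| choose 2` and `∑ (k
i choose 2)` survives in the quotient. This is the origin of the polydisk weight when `|q| < 1`. -/
theorem prod_qFact_div_eq_inv {n : ℕ} {p : ℝ} (hp : 0 < p) (k : Fin n →₀ ℕ) :
    p ^ (∑ i, ∑ j ∈ Finset.Ioi i, k i * k j) * ((∏ i, qFact p (k i)) / qFact p k.degree) =
      (∏ i, qFact p⁻¹ (k i)) / qFact p⁻¹ k.degree := by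
  have h1 := (qFact_pos hp k.degree).ne'
  have h2 := (qFact_pos (inv_pos.2 hp) k.degree).ne'
  have e : ∏ i, qFact p (k i) = p ^ (∑ i, (k i).choose 2) * ∏ i, qFact p⁻¹ (k i) := by
    rw [← Finset.prod_pow_eq_pow_sum, ← Finset.prod_mul_distrib]
    exact Finset.prod_congr rfl fun i _ => qFact_eq_pow_mul_qFact_inv hp _
  have e2 : qFact p k.degree = p ^ (∑ i, (k i).choose 2 + ∑ i, ∑ j ∈ Finset.Ioi i, k i * k j) *
      qFact p⁻¹ k.degree := by
    rw [qFact_eq_pow_mul_qFact_inv hp, ← choose_two_sum, Finsupp.degree_eq_sum]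
  rw [e, e2, pow_add]
  field_simp

theorem exists_bounds_prod_qFact_div {p : ℝ} (hp : 0 < p) (hp1 : p < 1) (n : ℕ) :
    ∃ c C : ℝ, 0 < c ∧ 0 < C ∧ ∀ k : Fin n →₀ ℕ,
      c ≤ (∏ i, qFact p (k i)) / qFact p k.degree ∧
        (∏ i, qFact p (k i)) / qFact p k.degree ≤ C := by
  obtain ⟨c, hc, h⟩ := exists_pos_le_qFact hp hp1
  have h1 : 0 < 1 - p := sub_pos.2 hp1
  refine ⟨c ^ n, c⁻¹, pow_pos hc n, inv_pos.2 hc, fun k => ?_⟩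
  have e : (∏ i, qFact p (k i)) / qFact p k.degree =
      (∏ i, ((1 - p) ^ k i * qFact p (k i))) / ((1 - p) ^ k.degree * qFact p k.degree) := by
    rw [Finset.prod_mul_distrib, Finset.prod_pow_eq_pow_sum, ← Finsupp.degree_eq_sum,
      mul_div_mul_left _ _ (pow_pos h1 _).ne']
  have hd : 0 < (1 - p) ^ k.degree * qFact p k.degree :=
    mul_pos (pow_pos h1 _) (qFact_pos hp _)
  have hlow : c ^ n ≤ ∏ i, ((1 - p) ^ k i * qFact p (k i)) := by
    calc c ^ n = ∏ _i : Fin n, c := by simp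
      _ ≤ _ := Finset.prod_le_prod (fun _ _ => hc.le) fun i _ => (h (k i)).1
  have hup : ∏ i, ((1 - p) ^ k i * qFact p (k i)) ≤ 1 :=
    Finset.prod_le_one (fun i _ => hc.le.trans (h (k i)).1) fun i _ => (h (k i)).2
  rw [e]
  constructor
  · rw [le_div_iff₀ hd]
    exact (mul_le_of_le_one_right (pow_pos hc n).le (h _).2).trans hlow
  · rw [← one_div]
    exact div_le_div₀ zero_le_one hup hc (h _).1

theorem exists_ballWeight_eq (q : ℂˣ) (n : ℕ) (hq : ‖(q : ℂ)‖ ≠ 1) :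
    ∃ c C : ℝ, 0 < c ∧ 0 < C ∧ ∀ k, c * (polydiskWeight q n).toFun k ≤ (ballWeight q n).toFun k ∧
      (ballWeight q n).toFun k ≤ C * (polydiskWeight q n).toFun k := by
  have h0 : 0 < ‖(q : ℂ)‖ := norm_pos_iff.2 q.ne_zero
  have hp : 0 < ‖(q : ℂ)‖ ^ (-2 : ℤ) := zpow_pos h0 _
  rcases lt_or_gt_of_ne hq with h | h
  · have hp1 : (‖(q : ℂ)‖ ^ (-2 : ℤ))⁻¹ = ‖(q : ℂ)‖ ^ 2 := by
      rw [zpow_neg, inv_inv]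
      rfl
    have hq2 : ‖(q : ℂ)‖ ^ 2 < 1 := pow_lt_one₀ h0.le h two_ne_zero
    obtain ⟨c, C, hc, hC, hb⟩ := exists_bounds_prod_qFact_div (pow_pos h0 2) hq2 n
    refine ⟨√c, √C, Real.sqrt_pos.2 hc, Real.sqrt_pos.2 hC, fun k => ?_⟩
    have e1 : (polydiskWeight q n).toFun k =
        √((‖(q : ℂ)‖ ^ 2) ^ (∑ i, ∑ j ∈ Finset.Ioi i, k i * k j)) := by
      rw [← pow_mul, mul_comm, pow_mul, Real.sqrt_sq (by positivity)]
      exact if_neg (not_le.2 h)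
    have e2 := prod_qFact_div_eq_inv hp k
    rw [hp1] at e2
    have e3 : (ballWeight q n).toFun k =
        √((∏ i, qFact (‖(q : ℂ)‖ ^ 2) (k i)) / qFact (‖(q : ℂ)‖ ^ 2) k.degree) *
          (polydiskWeight q n).toFun k := by
      rw [e1, ← Real.sqrt_mul' _ (by positivity), ← e2, ← hp1,
        inv_pow, mul_right_comm, mul_inv_cancel₀ (pow_pos hp _).ne', one_mul]
      rfl
    have h3 := (polydiskWeight q n).nonneg k
    rw [e3]
    exact ⟨mul_le_mul_of_nonneg_right (Real.sqrt_le_sqrt (hb k).1) h3,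
      mul_le_mul_of_nonneg_right (Real.sqrt_le_sqrt (hb k).2) h3⟩
  · have hp1 : ‖(q : ℂ)‖ ^ (-2 : ℤ) < 1 := zpow_lt_one_of_neg₀ h (by norm_num)
    obtain ⟨c, C, hc, hC, hb⟩ := exists_bounds_prod_qFact_div hp hp1 n
    refine ⟨√c, √C, Real.sqrt_pos.2 hc, Real.sqrt_pos.2 hC, fun k => ?_⟩
    have e1 : (polydiskWeight q n).toFun k = 1 := if_pos h.le
    rw [e1, mul_one, mul_one]
    exact ⟨Real.sqrt_le_sqrt (hb k).1, Real.sqrt_le_sqrt (hb k).2⟩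

theorem polydisk_eq_ball (n : ℕ) (q : ℂˣ) (r : ℝ≥0∞) (hq : ‖(q : ℂ)‖ ≠ 1) :
    QPolydisk q n r = QBall q n r ∧ ∃ φ : QPolydisk q n r ≃A[ℂ] QBall q n r,
      ∀ a : QPolydisk q n r, (φ a : QSeries q n) = (a : QSeries q n) := by
  obtain ⟨c, C, hc, -, h⟩ := exists_ballWeight_eq q n hq
  refine QWeight.exists_identity_equiv (C := C) (C' := c⁻¹) (fun k => (h k).2) (fun k => ?_) r
  rw [inv_mul_eq_div, le_div_iff₀ hc, mul_comm]
  exact (h k).1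

/-! ### Growth and weights for `|q| = 1` -/

/-- An exponential bound up to a polynomial factor compares the bases. -/
theorem le_of_forall_pow_le {a b C : ℝ} (hb : 0 < b) (d : ℕ)
    (h : ∀ m : ℕ, a ^ m ≤ C * (m + 1 : ℝ) ^ d * b ^ m) : a ≤ b := by
  by_contra! hab
  have hx : 1 < a / b := (one_lt_div hb).2 hab
  -- The limit is taken along `m + 1` so that the numerator is `(m + 1)^d`; the extra factor `a / b`
  -- offsets the shifted exponent in the denominator.
  have h0 := (((tendsto_pow_const_div_const_pow_of_one_lt d hx).comp
    (Filter.tendsto_add_atTop_nat 1)).const_mul (C * (a / b)))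
  rw [mul_zero] at h0
  obtain ⟨m, hm⟩ := (h0.eventually (gt_mem_nhds zero_lt_one)).exists
  have h1 := h m
  have h2 : 0 < b ^ m := pow_pos hb m
  have h3 : (a / b) ^ m ≤ C * (m + 1 : ℝ) ^ d := by
    rw [div_pow, div_le_iff₀ h2]
    exact h1
  have h4 : 0 < (a / b) ^ m := pow_pos (zero_lt_one.trans hx) m
  have h5 : C * (a / b) * (((m + 1 : ℕ) : ℝ) ^ d / (a / b) ^ (m + 1)) =
      C * (m + 1 : ℝ) ^ d / (a / b) ^ m := by
    have := (zero_lt_one.trans hx).ne'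
    rw [pow_succ]
    push_cast
    generalize a / b = x at this
    field_simp
  simp only [Function.comp_apply] at hm
  rw [h5, div_lt_one h4] at hm
  exact absurd h3 (not_le.2 hm)

theorem qFact_one (m : ℕ) : qFact 1 m = m.factorial := by
  induction m with
  | zero => simp [qFact]
  | succ m ih =>
    rw [qFact_succ, ih, Nat.factorial_succ]
    simp [qInt, mul_comm]

section weights

variable {q : ℂˣ} {n : ℕ}

theorem polydiskWeight_of_norm_eq_one (hq : ‖(q : ℂ)‖ = 1) (k : Fin n →₀ ℕ) :
    (polydiskWeight q n).toFun k = 1 := if_pos hq.ge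

theorem ballWeight_of_norm_eq_one (hq : ‖(q : ℂ)‖ = 1) (k : Fin n →₀ ℕ) :
    (ballWeight q n).toFun k =
      √((∏ i, ((k i).factorial : ℝ)) / (k.degree.factorial : ℝ)) := by
  change √((∏ i, qFact (‖(q : ℂ)‖ ^ (-2 : ℤ)) (k i)) / qFact (‖(q : ℂ)‖ ^ (-2 : ℤ)) k.degree) = _
  simp only [hq, one_zpow, qFact_one]

theorem ballWeight_pos (q : ℂˣ) (k : Fin n →₀ ℕ) : 0 < (ballWeight q n).toFun k := by
  have hp : 0 < ‖(q : ℂ)‖ ^ (-2 : ℤ) := zpow_pos (norm_pos_iff.2 q.ne_zero) _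
  exact Real.sqrt_pos.2 (div_pos (Finset.prod_pos fun i _ => qFact_pos hp _) (qFact_pos hp _))

theorem ballWeight_single (hq : ‖(q : ℂ)‖ = 1) (i : Fin n) (m : ℕ) :
    (ballWeight q n).toFun (Finsupp.single i m) = 1 := by
  rw [ballWeight_of_norm_eq_one hq, Finset.prod_eq_single i]
  · simp [Nat.factorial_ne_zero]
  · intro j _ hj
    simp [hj.symm]
  · simp

/-- The decay that separates the two algebras for `q ≠ 1`: pure powers have weight 1 in both, but
mixed monomials are small in the ball. -/
theorem ballWeight_single_add_single_sq (hq : ‖(q : ℂ)‖ = 1) {i j : Fin n} (hij : i ≠ j) (m : ℕ) :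
    (ballWeight q n).toFun (Finsupp.single i m + Finsupp.single j m) ^ 2 * m.centralBinom = 1 := by
  rw [ballWeight_of_norm_eq_one hq, Real.sq_sqrt (by positivity), Finset.prod_eq_mul i j hij]
  · have h := Nat.choose_mul_factorial_mul_factorial (Nat.le_mul_of_pos_left m two_pos)
    have e : 2 * m - m = m := by omega
    rw [e] at h
    have h' : ((m.centralBinom : ℝ) * m.factorial * m.factorial) = (2 * m).factorial := by
      exact_mod_cast h
    have h1 : ((2 * m).factorial : ℝ) ≠ 0 := by exact_mod_cast Nat.factorial_ne_zero _
    simp only [map_add, Finsupp.degree_single, Finsupp.add_apply, Finsupp.single_apply, hij,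
      hij.symm, if_true, if_false, add_zero, zero_add, ← two_mul]
    rw [div_mul_eq_mul_div, div_eq_one_iff_eq h1, ← h']
    ring
  · intro l _ hl
    simp [hl.1.symm, hl.2.symm]
  · simp
  · simp

theorem qCross_single_self (i : Fin n) (a b : ℕ) :
    qCross (Finsupp.single i a) (Finsupp.single i b) = 0 := by
  refine Finset.sum_eq_zero fun s _ => Finset.sum_eq_zero fun t ht => ?_
  have := (Finset.mem_Ioi.1 ht).ne
  by_cases hs : i = s
  · subst hs
    simp [this]
  · simp [Finsupp.single_apply, hs]

end weights

/-! ### Low order and leading coefficients -/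

namespace QSeries

variable {q : ℂˣ} {n : ℕ}

theorem coeff_zero_mul (a b : QSeries q n) : coeff 0 (a * b) = coeff 0 a * coeff 0 b := by
  simp [coeff_mul]

/-- Linear coefficients are derivations at the origin; no power of `q` enters because one factor is
always of degree zero. -/
theorem coeff_single_one_mul (i : Fin n) (a b : QSeries q n) :
    coeff (Finsupp.single i 1) (a * b) = coeff 0 a * coeff (Finsupp.single i 1) b +
      coeff (Finsupp.single i 1) a * coeff 0 b := by
  simp [coeff_mul, Finsupp.antidiagonal_single, Finset.Nat.antidiagonal_succ]

theorem coeff_single_two_mul (i : Fin n) {a b : QSeries q n} (ha : coeff 0 a = 0)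
    (hb : coeff 0 b = 0) : coeff (Finsupp.single i 2) (a * b) =
      coeff (Finsupp.single i 1) a * coeff (Finsupp.single i 1) b := by
  simp [coeff_mul, Finsupp.antidiagonal_single, Finset.Nat.antidiagonal_succ, ha, hb,
    qCross_single_self]

/-- `x^k` is, up to terms of higher degree, the only monomial in `a`, with coefficient of
absolute value `c`. -/
structure HasLead (a : QSeries q n) (k : Fin n →₀ ℕ) (c : ℝ) : Prop where
  eq_zero : ∀ m : Fin n →₀ ℕ, m.degree ≤ k.degree → m ≠ k → coeff m a = 0
  norm_eq : ‖coeff k a‖ = c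

/-- In total degree at most `|k| + |l|`, any pair other than `(k, l)` has a factor of degree at most
its leading degree that is not the leading monomial. The reordering factor has modulus 1 because
`|q| = 1`. -/
theorem HasLead.mul (hq : ‖(q : ℂ)‖ = 1) {a b : QSeries q n} {k l : Fin n →₀ ℕ} {c d : ℝ}
    (ha : a.HasLead k c) (hb : b.HasLead l d) : (a * b).HasLead (k + l) (c * d) := by
  have key : ∀ p : (Fin n →₀ ℕ) × (Fin n →₀ ℕ), (p.1 + p.2).degree ≤ (k + l).degree →
      p ≠ (k, l) → coeff p.1 a * coeff p.2 b = 0 := by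
    rintro ⟨s, t⟩ hdeg hne
    simp only [map_add] at hdeg
    by_cases hs : s.degree ≤ k.degree
    · by_cases hsk : s = k
      · subst hsk
        have ht : t ≠ l := fun h => hne (by rw [h])
        simp [hb.eq_zero t (by omega) ht]
      · simp [ha.eq_zero s hs hsk]
    · have ht : t ≠ l := by
        rintro rfl
        omega
      simp [hb.eq_zero t (by omega) ht]
  constructor
  · intro m hm hne
    rw [coeff_mul]
    refine Finset.sum_eq_zero fun p hp => ?_
    rw [Finset.HasAntidiagonal.mem_antidiagonal] at hp
    subst hp
    rw [key p hm (by rintro rfl; exact hne rfl), mul_zero]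
  · rw [coeff_mul, Finset.sum_eq_single (k, l)]
    · simp [hq, ha.norm_eq, hb.norm_eq]
    · intro p hp hne
      rw [Finset.HasAntidiagonal.mem_antidiagonal] at hp
      rw [key p (by rw [hp]) hne, mul_zero]
    · simp

theorem HasLead.pow (hq : ‖(q : ℂ)‖ = 1) {a : QSeries q n} {k : Fin n →₀ ℕ} {c : ℝ}
    (ha : a.HasLead k c) (m : ℕ) : (a ^ m).HasLead (m • k) (c ^ m) := by
  induction m with
  | zero =>
    refine ⟨fun l _ hl => ?_, ?_⟩
    · rw [pow_zero, coeff_one, if_neg (by simpa using hl)]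
    · simp [coeff_one]
  | succ m ih =>
    rw [pow_succ, pow_succ, succ_nsmul]
    exact ih.mul hq ha

end QSeries

/-! ### Leading terms and `q`-commutation of generators -/

namespace QWeight

variable {q : ℂˣ} {n : ℕ}

theorem le_holNorm_of_hasLead {w : QWeight q n} {r : ℝ≥0∞} {a : w.holAlg r} {k : Fin n →₀ ℕ}
    {c : ℝ} (h : (a : QSeries q n).HasLead k c) (ρ) :
    c * w.toFun k * ρ.1 ^ k.degree ≤ w.holNorm r ρ a := by
  rw [← h.norm_eq]
  exact w.term_le_holNorm r ρ a k

theorem holX_pow (w : QWeight q n) (r : ℝ≥0∞) (i : Fin n) (m : ℕ) :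
    w.holX r i ^ m = w.holMonomial r (Finsupp.single i m) := by
  induction m with
  | zero => simp [holMonomial_zero]
  | succ m ih =>
    rw [pow_succ, ih, holMonomial_mul, qCross_single_self, pow_zero, one_smul, Finsupp.single_add]

theorem exists_ne_one_holX_mul_holX (hq1 : (q : ℂ) ≠ 1) (w : QWeight q n) (r : ℝ≥0∞)
    {i j : Fin n} (hij : i ≠ j) :
    ∃ c : ℂ, c ≠ 1 ∧ w.holX r i * w.holX r j = c • (w.holX r j * w.holX r i) := by
  rcases lt_or_gt_of_ne hij with h | h
  · exact ⟨q, hq1, w.holX_mul_holX r h⟩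
  · refine ⟨(q : ℂ)⁻¹, fun h1 => hq1 (inv_eq_one.1 h1), ?_⟩
    rw [w.holX_mul_holX r h, smul_smul, inv_mul_cancel₀ q.ne_zero, one_smul]

/-! ### Isomorphisms in the noncommutative case -/

variable {w w' : QWeight q n} {r : ℝ≥0∞}

theorem exists_ne_one_map_holX (hq1 : (q : ℂ) ≠ 1) (φ : w.holAlg r ≃A[ℂ] w'.holAlg r)
    {i j : Fin n} (hij : i ≠ j) :
    ∃ c : ℂ, c ≠ 1 ∧ (φ (w.holX r i) * φ (w.holX r j) : QSeries q n) =
      c • ((φ (w.holX r j) * φ (w.holX r i) : QSeries q n)) := by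
  obtain ⟨c, hc, h⟩ := w.exists_ne_one_holX_mul_holX hq1 r hij
  refine ⟨c, hc, ?_⟩
  have h2 := congrArg (fun a => (φ a : QSeries q n)) h
  simpa using h2

/-- If the image of `x_i` had a nonzero constant term, the relations with `c ≠ 1` would kill the
constant and linear parts of every other image. The linear parts would then span at most a line, and
as `n ≥ 2` some nonzero derivation at the origin would vanish on all images, hence by continuity on
the whole algebra. -/
theorem coeff_zero_map_holX (hn : 2 ≤ n) (hr : 0 < r) (hq1 : (q : ℂ) ≠ 1)
    (hw' : ∀ k, 0 < w'.toFun k) (φ : w.holAlg r ≃A[ℂ] w'.holAlg r) (i : Fin n) :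
    (φ (w.holX r i) : QSeries q n).coeff 0 = 0 := by
  by_contra ha
  have hj : ∀ j, j ≠ i → ∀ s, (φ (w.holX r j) : QSeries q n).coeff (Finsupp.single s 1) = 0 := by
    intro j hji s
    obtain ⟨c, hc, h⟩ := exists_ne_one_map_holX hq1 φ hji.symm
    have h0 := congrArg (QSeries.coeff 0) h
    have h1 := congrArg (QSeries.coeff (Finsupp.single s 1)) h
    simp only [QSeries.coeff_smul, QSeries.coeff_zero_mul, QSeries.coeff_single_one_mul] at h0 h1
    have hc' : 1 - c ≠ 0 := sub_ne_zero.2 hc.symm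
    have h2 : (φ (w.holX r j) : QSeries q n).coeff 0 = 0 := by
      have : (1 - c) * ((φ (w.holX r i) : QSeries q n).coeff 0 *
        (φ (w.holX r j) : QSeries q n).coeff 0) = 0 := by linear_combination h0
      simpa [hc', ha] using this
    rw [h2] at h1
    have : (1 - c) * ((φ (w.holX r i) : QSeries q n).coeff 0 *
      (φ (w.holX r j) : QSeries q n).coeff (Finsupp.single s 1)) = 0 := by linear_combination h1
    simpa [hc', ha] using this
  let s : Fin n := ⟨0, by omega⟩
  let t : Fin n := ⟨1, by omega⟩
  have hst : s ≠ t := by simp [s, t]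
  obtain ⟨α, β, hne, hv⟩ : ∃ α β : ℂ, (α ≠ 0 ∨ β ≠ 0) ∧
      α * (φ (w.holX r i) : QSeries q n).coeff (Finsupp.single s 1) +
        β * (φ (w.holX r i) : QSeries q n).coeff (Finsupp.single t 1) = 0 := by
    by_cases h : (φ (w.holX r i) : QSeries q n).coeff (Finsupp.single s 1) = 0
    · exact ⟨1, 0, Or.inl one_ne_zero, by simp [h]⟩
    · exact ⟨(φ (w.holX r i) : QSeries q n).coeff (Finsupp.single t 1),
        -(φ (w.holX r i) : QSeries q n).coeff (Finsupp.single s 1), Or.inr (neg_ne_zero.2 h),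
        by ring⟩
  let D : w'.holAlg r →ₗ[ℂ] ℂ :=
    α • w'.holCoeff r (Finsupp.single s 1) + β • w'.holCoeff r (Finsupp.single t 1)
  have hD : ∀ a, D a = α * (a : QSeries q n).coeff (Finsupp.single s 1) +
      β * (a : QSeries q n).coeff (Finsupp.single t 1) := fun a => rfl
  have hDc : Continuous D := by
    have h1 := w'.continuous_holCoeff hr (hw' (Finsupp.single s 1))
    have h2 := w'.continuous_holCoeff hr (hw' (Finsupp.single t 1))
    exact (h1.const_smul α).add (h2.const_smul β)
  -- The kernel of `D` is a subalgebra because `D` is a derivation at the origin, so it suffices to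
  -- check generators.
  let S : Subalgebra ℂ (w'.holAlg r) :=
    { carrier := {a | D a = 0}
      add_mem' := fun {a b} ha hb => by
        change D (a + b) = 0
        rw [map_add, show D a = 0 from ha, show D b = 0 from hb, add_zero]
      mul_mem' := fun {a b} ha hb => by
        have ha : D a = 0 := ha
        have hb : D b = 0 := hb
        change D (a * b) = 0
        rw [hD] at ha hb ⊢
        rw [MulMemClass.coe_mul, QSeries.coeff_single_one_mul, QSeries.coeff_single_one_mul]
        linear_combination (a : QSeries q n).coeff 0 * hb + (b : QSeries q n).coeff 0 * ha
      algebraMap_mem' := fun z => by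
        change D _ = 0
        rw [Algebra.algebraMap_eq_smul_one, map_smul, hD]
        simp [QSeries.coeff_one] }
  have hS : ∀ k, φ (w.holMonomial r k) ∈ S := by
    refine w.holMonomial_mem_of_holX_mem r (S.comap (φ : w.holAlg r →ₐ[ℂ] w'.holAlg r)) fun j => ?_
    change D (φ (w.holX r j)) = 0
    rw [hD]
    by_cases h : j = i
    · rw [h, hv]
    · rw [hj j h, hj j h, mul_zero, mul_zero, add_zero]
  have hzero : D ∘ₗ φ.toLinearMap = 0 :=
    eq_of_eq_on_holMonomial hr _ _ (hDc.comp φ.continuous) continuous_zero hS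
  have hD0 : ∀ a, D a = 0 := fun a => by
    simpa using LinearMap.congr_fun hzero (φ.symm a)
  rcases hne with h | h
  · apply h
    have := hD0 (w'.holX r s)
    simpa [hD, QSeries.monomial, Finsupp.single_left_inj, hst, hst.symm] using this
  · apply h
    have := hD0 (w'.holX r t)
    simpa [hD, QSeries.monomial, Finsupp.single_left_inj, hst, hst.symm] using this

theorem exists_eq_single_add {k : Fin n →₀ ℕ} (hk : k ≠ 0) :
    ∃ i l, k = Finsupp.single i 1 + l := by
  obtain ⟨i, hi⟩ := Finsupp.ne_iff.1 hk
  refine ⟨i, k - Finsupp.single i 1, (add_tsub_cancel_of_le ?_).symm⟩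
  rw [Finsupp.single_le_iff]
  exact Nat.one_le_iff_ne_zero.2 hi

/-- The chain rule at the origin. -/
theorem coeff_single_map (hr : 0 < r) (hw : ∀ k, 0 < w.toFun k) (hw' : ∀ k, 0 < w'.toFun k)
    (φ : w.holAlg r ≃A[ℂ] w'.holAlg r)
    (h0 : ∀ i, (φ (w.holX r i) : QSeries q n).coeff 0 = 0) (a : w.holAlg r) (t : Fin n) :
    (φ a : QSeries q n).coeff (Finsupp.single t 1) =
      ∑ i, (a : QSeries q n).coeff (Finsupp.single i 1) *
        (φ (w.holX r i) : QSeries q n).coeff (Finsupp.single t 1) := by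
  let f : w.holAlg r →ₗ[ℂ] ℂ := w'.holCoeff r (Finsupp.single t 1) ∘ₗ φ.toLinearMap
  let g : w.holAlg r →ₗ[ℂ] ℂ := ∑ i, (φ (w.holX r i) : QSeries q n).coeff (Finsupp.single t 1) •
    w.holCoeff r (Finsupp.single i 1)
  have hf : Continuous f := (w'.continuous_holCoeff hr (hw' _)).comp φ.continuous
  have hg' : ∀ a, g a = ∑ i, (φ (w.holX r i) : QSeries q n).coeff (Finsupp.single t 1) *
      (a : QSeries q n).coeff (Finsupp.single i 1) := fun a => by simp [g]
  have hg : Continuous g := by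
    have : (g : w.holAlg r → ℂ) = fun a => ∑ i,
      (φ (w.holX r i) : QSeries q n).coeff (Finsupp.single t 1) *
        w.holCoeff r (Finsupp.single i 1) a := funext hg'
    rw [this]
    exact continuous_finsetSum _ fun i _ =>
      continuous_const.mul (w.continuous_holCoeff hr (hw _))
  have hmul : ∀ i l, (φ (w.holMonomial r (Finsupp.single i 1 + l)) : QSeries q n) =
      (q : ℂ) ^ qCross (Finsupp.single i 1) l •
        ((φ (w.holX r i) : QSeries q n) * (φ (w.holMonomial r l) : QSeries q n)) := by
    intro i l
    rw [holMonomial_add, map_smul, map_mul]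
    rfl
  have hconst : ∀ k, k ≠ 0 → (φ (w.holMonomial r k) : QSeries q n).coeff 0 = 0 := by
    intro k hk
    obtain ⟨i, l, rfl⟩ := exists_eq_single_add hk
    rw [hmul, QSeries.coeff_smul, QSeries.coeff_zero_mul, h0, zero_mul, mul_zero]
  have hfg : f = g := by
    refine eq_of_eq_on_holMonomial hr f g hf hg fun k => ?_
    rw [hg']
    change (φ (w.holMonomial r k) : QSeries q n).coeff (Finsupp.single t 1) = _
    by_cases hk : k = 0
    · subst hk
      simp [holMonomial_zero, QSeries.coeff_one]
    obtain ⟨i, l, rfl⟩ := exists_eq_single_add hk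
    by_cases hl : l = 0
    · subst hl
      rw [Finset.sum_eq_single i]
      · simp [QSeries.monomial]
      · intro j _ hj
        simp [QSeries.monomial, Finsupp.single_left_inj, hj]
      · simp
    -- For degree at least 2 the image is a product of two series without constant term, so it has
    -- no linear part.
    · rw [hmul, QSeries.coeff_smul, QSeries.coeff_single_one_mul, h0, hconst l hl, zero_mul,
        mul_zero, add_zero, mul_zero, Finset.sum_eq_zero]
      intro j _
      have hne : Finsupp.single j 1 ≠ Finsupp.single i 1 + l := by
        intro h
        have h1 := congrArg Finsupp.degree h
        simp only [map_add, Finsupp.degree_single] at h1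
        exact hl ((Finsupp.degree_eq_zero_iff l).1 (by omega))
      simp [QSeries.monomial, hne]
  have := LinearMap.congr_fun hfg a
  rw [hg'] at this
  exact this.trans (Finset.sum_congr rfl fun i _ => mul_comm _ _)

/-- The linear part of an isomorphism is a monomial matrix. -/
theorem exists_unique_linear_coeff (hn : 2 ≤ n) (hr : 0 < r) (hq1 : (q : ℂ) ≠ 1)
    (hw : ∀ k, 0 < w.toFun k) (hw' : ∀ k, 0 < w'.toFun k) (φ : w.holAlg r ≃A[ℂ] w'.holAlg r)
    (i : Fin n) : ∃ s, (φ (w.holX r i) : QSeries q n).coeff (Finsupp.single s 1) ≠ 0 ∧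
      ∀ t, t ≠ s → (φ (w.holX r i) : QSeries q n).coeff (Finsupp.single t 1) = 0 := by
  have h0 := coeff_zero_map_holX hn hr hq1 hw' φ
  have h0' := coeff_zero_map_holX hn hr hq1 hw φ.symm
  -- The chain rule for `φ.symm` recovers the coefficient 1 of `x_i` from the linear part of its
  -- image, so that part is nonzero.
  have hex : ∀ i, ∃ s, (φ (w.holX r i) : QSeries q n).coeff (Finsupp.single s 1) ≠ 0 := by
    intro i
    by_contra! h
    have h1 := coeff_single_map hr hw' hw φ.symm h0' (φ (w.holX r i)) i
    simp [h, QSeries.monomial] at h1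
  -- If two images both involved `x_s` linearly, the coefficients of `x_s²` in `φ(x_i) φ(x_j) = c
  -- φ(x_j) φ(x_i)` would force `c = 1`.
  have hcol : ∀ i j s, (φ (w.holX r i) : QSeries q n).coeff (Finsupp.single s 1) ≠ 0 →
      (φ (w.holX r j) : QSeries q n).coeff (Finsupp.single s 1) ≠ 0 → i = j := by
    intro i j s hi hj
    by_contra hij
    obtain ⟨c, hc, h⟩ := exists_ne_one_map_holX hq1 φ hij
    have h2 := congrArg (QSeries.coeff (Finsupp.single s 2)) h
    rw [QSeries.coeff_smul, QSeries.coeff_single_two_mul s (h0 i) (h0 j),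
      QSeries.coeff_single_two_mul s (h0 j) (h0 i)] at h2
    have h3 : (1 - c) * ((φ (w.holX r i) : QSeries q n).coeff (Finsupp.single s 1) *
      (φ (w.holX r j) : QSeries q n).coeff (Finsupp.single s 1)) = 0 := by linear_combination h2
    simp [sub_ne_zero.2 hc.symm, hi, hj] at h3
  choose σ hσ using hex
  have hinj : Function.Injective σ := fun i j hij => hcol i j (σ i) (hσ i) (hij ▸ hσ j)
  refine ⟨σ i, hσ i, fun t ht => ?_⟩
  by_contra hne
  -- Every column already belongs to some row `j`, so a second entry in row `i` would share the
  -- column of another row.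
  obtain ⟨j, rfl⟩ := (Finite.injective_iff_surjective.1 hinj) t
  exact ht (by rw [hcol i j _ hne (hσ j)])

theorem hasLead_map_holX {φ : w.holAlg r ≃A[ℂ] w'.holAlg r} {i s : Fin n}
    (h0 : (φ (w.holX r i) : QSeries q n).coeff 0 = 0)
    (hs : ∀ t, t ≠ s → (φ (w.holX r i) : QSeries q n).coeff (Finsupp.single t 1) = 0) :
    (φ (w.holX r i) : QSeries q n).HasLead (Finsupp.single s 1)
      ‖(φ (w.holX r i) : QSeries q n).coeff (Finsupp.single s 1)‖ := by
  refine ⟨fun m hm hne => ?_, rfl⟩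
  by_cases hm0 : m = 0
  · rw [hm0, h0]
  obtain ⟨t, l, rfl⟩ := exists_eq_single_add hm0
  simp only [map_add, Finsupp.degree_single] at hm
  have hl : l = 0 := (Finsupp.degree_eq_zero_iff l).1 (by omega)
  subst hl
  rw [add_zero] at hne ⊢
  exact hs t fun h => hne (by rw [h])

end QWeight

/-! ### Finite radii and a bound on leading coefficients -/

namespace QWeight

variable {q : ℂˣ} {n : ℕ}

theorem exists_radius_eq {R ρ : ℝ} (h0 : 0 < ρ) (h : ρ < R) :
    ∃ ρ' : {ρ : ℝ // 0 < ρ ∧ ENNReal.ofReal ρ < ENNReal.ofReal R}, ρ'.1 = ρ :=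
  ⟨⟨ρ, h0, (ENNReal.ofReal_lt_ofReal_iff (h0.trans h)).2 h⟩, rfl⟩

theorem radius_lt {R : ℝ} (hR : 0 < R)
    (ρ : {ρ : ℝ // 0 < ρ ∧ ENNReal.ofReal ρ < ENNReal.ofReal R}) : ρ.1 < R :=
  (ENNReal.ofReal_lt_ofReal_iff hR).1 ρ.2.2

/-- A Schwarz lemma: if a hom between algebras whose weights are `1` on pure powers maps a
generator to a multiple of a generator plus higher order terms, then the multiple has absolute
value at most `1`. -/
theorem hasLead_le_one {w w' : QWeight q n} {R : ℝ} (hR : 0 < R) (hq : ‖(q : ℂ)‖ = 1)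
    (hw : ∀ i m, w.toFun (Finsupp.single i m) = 1) (hw' : ∀ i m, w'.toFun (Finsupp.single i m) = 1)
    (φ : w.holAlg (ENNReal.ofReal R) ≃A[ℂ] w'.holAlg (ENNReal.ofReal R)) {s t : Fin n} {d : ℝ}
    (h : (φ (w.holX _ s) : QSeries q n).HasLead (Finsupp.single t 1) d) : d ≤ 1 := by
  by_contra! hd
  have hd0 : 0 < d := zero_lt_one.trans hd
  -- At radius `R / d`, admissible when `d > 1`, the leading term of the image of `x_s^m` has size
  -- `d^m (R / d)^m = R^m`, too large to be `O(ρ^m)` with `ρ < R`.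
  obtain ⟨τ, hτ⟩ := exists_radius_eq (R := R) (div_pos hR hd0) (div_lt_self hR hd)
  obtain ⟨ρ, C, -, hC⟩ := exists_bound (ENNReal.ofReal_pos.2 hR) φ.toLinearMap φ.continuous τ
  have key : ∀ m : ℕ, R ^ m ≤ C * (m + 1 : ℝ) ^ 0 * ρ.1 ^ m := by
    intro m
    have h1 : (φ (w.holX _ s ^ m) : QSeries q n).HasLead (m • Finsupp.single t 1) (d ^ m) := by
      rw [map_pow]
      exact h.pow hq m
    have h2 := (le_holNorm_of_hasLead h1 τ).trans (hC _)
    rw [holX_pow, holNorm_holMonomial, hw, Finsupp.smul_single, smul_eq_mul, mul_one, hw', mul_one,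
      Finsupp.degree_single, Finsupp.degree_single, hτ, ← mul_pow, mul_div_cancel₀ _ hd0.ne',
      one_mul] at h2
    rwa [pow_zero, mul_one]
  exact (le_of_forall_pow_le ρ.2.1 0 key).not_gt (radius_lt hR ρ)

end QWeight

/-! ### Nonisomorphism for `|q| = 1`, `q ≠ 1` -/

open QWeight

theorem four_pow_le_mul_centralBinom (m : ℕ) : (4 : ℝ) ^ m ≤ 2 * (m + 1) * m.centralBinom := by
  rcases Nat.eq_zero_or_pos m with rfl | hm
  · simp
  · have h : (4 : ℝ) ^ m ≤ 2 * m * m.centralBinom := by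
      exact_mod_cast Nat.four_pow_le_two_mul_self_mul_centralBinom m hm
    refine h.trans ?_
    gcongr
    linarith

theorem isEmpty_equiv_of_ne_one {n : ℕ} (hn : 2 ≤ n) {q : ℂˣ} (hq : ‖(q : ℂ)‖ = 1)
    (hq1 : (q : ℂ) ≠ 1) {R : ℝ} (hR : 0 < R) :
    IsEmpty (QPolydisk q n (ENNReal.ofReal R) ≃A[ℂ] QBall q n (ENNReal.ofReal R)) := by
  refine ⟨fun φ => ?_⟩
  have hr := ENNReal.ofReal_pos.2 hR
  have hD : ∀ k, 0 < (polydiskWeight q n).toFun k := fun k => by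
    rw [polydiskWeight_of_norm_eq_one hq]
    exact one_pos
  have hB : ∀ k, 0 < (ballWeight q n).toFun k := ballWeight_pos q
  -- The linear coefficients of `φ.symm` at `x_i` and of `φ` at the corresponding `x_s` multiply to
  -- 1, and the latter has modulus at most 1 by the Schwarz lemma.
  have hlead : ∀ i, ∃ s c, 1 ≤ c ∧
      (φ.symm ((ballWeight q n).holX _ i) : QSeries q n).HasLead (Finsupp.single s 1) c := by
    intro i
    have hψ0 := coeff_zero_map_holX hn hr hq1 hD φ.symm
    have hφ0 := coeff_zero_map_holX hn hr hq1 hB φ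
    obtain ⟨s, hs, hs'⟩ := exists_unique_linear_coeff hn hr hq1 hB hD φ.symm i
    obtain ⟨t, ht, ht'⟩ := exists_unique_linear_coeff hn hr hq1 hD hB φ s
    have hc := coeff_single_map hr hD hB φ hφ0 (φ.symm ((ballWeight q n).holX _ i)) i
    rw [Finset.sum_eq_single s (fun j _ hj => by rw [hs' j hj, zero_mul]) (by simp),
      ContinuousAlgEquiv.apply_symm_apply] at hc
    simp only [coe_holMonomial, QSeries.monomial, QSeries.coeff_mk, if_true] at hc
    have hit : i = t := by
      by_contra hne
      rw [ht' i hne, mul_zero] at hc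
      exact one_ne_zero hc
    have hd := hasLead_le_one hR hq (fun i m => polydiskWeight_of_norm_eq_one hq _)
      (fun i m => ballWeight_single hq i m) φ (hasLead_map_holX (hφ0 s) ht')
    rw [← hit] at hd
    refine ⟨s, _, ?_, hasLead_map_holX (hψ0 i) hs'⟩
    have hc' := congrArg norm hc
    rw [norm_one, norm_mul] at hc'
    rw [hc']
    exact mul_le_of_le_one_right (norm_nonneg _) hd
  let i : Fin n := ⟨0, by omega⟩
  let j : Fin n := ⟨1, by omega⟩
  have hij : i ≠ j := by simp [i, j]
  obtain ⟨s, c, hc, hsc⟩ := hlead i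
  obtain ⟨t, d, hd, htd⟩ := hlead j
  -- Any `τ < R` with `4 τ^4 > R^4` works; here `4 (3/4)^4 = 81/64`.
  obtain ⟨τ, hτ⟩ := exists_radius_eq (R := R) (ρ := 3 / 4 * R) (by positivity) (by linarith)
  obtain ⟨ρ, C, hC0, hC⟩ := exists_bound hr φ.symm.toLinearMap φ.symm.continuous τ
  -- The continuity bound at `x_i^m x_j^m`, squared: the central binomial coefficient from the ball
  -- weight contributes `4^m` up to a linear factor.
  have key : ∀ m : ℕ, (4 * τ.1 ^ 4) ^ m ≤ (2 * C ^ 2) * (m + 1 : ℝ) ^ 1 * (ρ.1 ^ 4) ^ m := by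
    intro m
    have h1 := (hsc.pow hq m).mul hq (htd.pow hq m)
    have h2 : (φ.symm ((ballWeight q n).holX _ i ^ m * (ballWeight q n).holX _ j ^ m) :
        QSeries q n).HasLead (m • Finsupp.single s 1 + m • Finsupp.single t 1) (c ^ m * d ^ m) := by
      rw [map_mul, map_pow, map_pow]
      exact h1
    have h3 := (le_holNorm_of_hasLead h2 τ).trans (hC _)
    rw [holX_pow, holX_pow, holMonomial_mul, map_smul_eq_mul, holNorm_holMonomial] at h3
    simp only [polydiskWeight_of_norm_eq_one hq, map_add, map_nsmul, Finsupp.degree_single,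
      Units.val_inv_eq_inv_val, norm_pow, norm_inv, hq, inv_one, one_pow, one_mul, mul_one,
      smul_eq_mul] at h3
    have h4 : τ.1 ^ (m + m) ≤ c ^ m * d ^ m * τ.1 ^ (m + m) :=
      le_mul_of_one_le_left (pow_pos τ.2.1 _).le
        (one_le_mul_of_one_le_of_one_le (one_le_pow₀ hc) (one_le_pow₀ hd))
    have h5 := pow_le_pow_left₀ (pow_pos τ.2.1 _).le (h4.trans h3) 2
    have h6 := ballWeight_single_add_single_sq hq hij m
    have h7 := four_pow_le_mul_centralBinom m
    have h8 : (0 : ℝ) ≤ (τ.1 ^ (m + m)) ^ 2 := by positivity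
    have h9 : (0 : ℝ) ≤ 2 * (m + 1) * m.centralBinom := by positivity
    calc (4 * τ.1 ^ 4) ^ m = 4 ^ m * (τ.1 ^ (m + m)) ^ 2 := by ring
      _ ≤ (2 * (m + 1) * m.centralBinom) * (τ.1 ^ (m + m)) ^ 2 := by gcongr
      _ ≤ (2 * (m + 1) * m.centralBinom) * (C * ((ballWeight q n).toFun
          (Finsupp.single i m + Finsupp.single j m) * ρ.1 ^ (m + m))) ^ 2 := by gcongr
      _ = (2 * C ^ 2) * (m + 1 : ℝ) ^ 1 * (ρ.1 ^ 4) ^ m * ((ballWeight q n).toFun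
          (Finsupp.single i m + Finsupp.single j m) ^ 2 * m.centralBinom) := by ring
      _ = _ := by rw [h6, mul_one]
  have h1 := le_of_forall_pow_le (pow_pos ρ.2.1 4) 1 key
  have h2 := pow_lt_pow_left₀ (radius_lt hR ρ) ρ.2.1.le (four_ne_zero)
  rw [hτ] at h1
  have h3 := pow_pos hR 4
  nlinarith

/-! ### The commutative case -/

section commutative

variable {n : ℕ}

/-- The value of a power series in commuting variables at a point. -/
noncomputable def QSeries.eval (ζ : Fin n → ℂ) (a : QSeries 1 n) : ℂ :=
  ∑' k : Fin n →₀ ℕ, a.coeff k * ∏ i, ζ i ^ k i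

theorem norm_eval_term_le {r : ℝ≥0∞} {ρ : {ρ : ℝ // 0 < ρ ∧ ENNReal.ofReal ρ < r}}
    {ζ : Fin n → ℂ} (hζ : ‖ζ‖ ≤ ρ.1) (a : QPolydisk 1 n r) (k : Fin n →₀ ℕ) :
    ‖(a : QSeries 1 n).coeff k * ∏ i, ζ i ^ k i‖ ≤
      (polydiskWeight 1 n).term ρ.1 (a : QSeries 1 n) k := by
  rw [QWeight.term, polydiskWeight_of_norm_eq_one (by simp), mul_one, norm_mul, norm_prod,
    Finsupp.degree_eq_sum, ← Finset.prod_pow_eq_pow_sum]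
  gcongr with i _
  rw [norm_pow]
  exact pow_le_pow_left₀ (norm_nonneg _) ((norm_le_pi_norm ζ i).trans hζ) _

/-- Evaluation at a point of the polydisk is a continuous character. -/
theorem exists_algHom_eval {R : ℝ} {ζ : Fin n → ℂ} (hζ : ‖ζ‖ < R) :
    ∃ e : QPolydisk 1 n (ENNReal.ofReal R) →ₐ[ℂ] ℂ, Continuous e ∧
      ∀ a, e a = QSeries.eval ζ (a : QSeries 1 n) := by
  obtain ⟨ρ, hρ⟩ := exists_radius_eq (R := R) (ρ := (‖ζ‖ + R) / 2)
    (by linarith [norm_nonneg ζ]) (by linarith)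
  have hζρ : ‖ζ‖ ≤ ρ.1 := by linarith
  have hsn : ∀ a : QPolydisk 1 n (ENNReal.ofReal R),
      Summable fun k => ‖(a : QSeries 1 n).coeff k * ∏ i, ζ i ^ k i‖ := fun a =>
    (a.2 ρ.1 ρ.2.1 ρ.2.2).of_nonneg_of_le (fun _ => norm_nonneg _) (norm_eval_term_le hζρ a)
  let f : QPolydisk 1 n (ENNReal.ofReal R) →ₗ[ℂ] ℂ :=
    { toFun := fun a => QSeries.eval ζ (a : QSeries 1 n)
      map_add' := fun a b => by
        rw [QSeries.eval, QSeries.eval, QSeries.eval, ← (hsn a).of_norm.tsum_add (hsn b).of_norm]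
        exact tsum_congr fun k => by simp [add_mul]
      map_smul' := fun z a => by
        rw [QSeries.eval, QSeries.eval, RingHom.id_apply, smul_eq_mul, ← tsum_mul_left]
        exact tsum_congr fun k => by simp [mul_assoc] }
  have hone : f 1 = 1 := by
    change QSeries.eval ζ (1 : QSeries 1 n) = 1
    rw [QSeries.eval, tsum_eq_single 0]
    · simp [QSeries.coeff_one]
    · intro k hk
      simp [QSeries.coeff_one, hk]
  have hmul : ∀ a b, f (a * b) = f a * f b := by
    intro a b
    change QSeries.eval ζ ((a : QSeries 1 n) * b) = QSeries.eval ζ a * QSeries.eval ζ b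
    have hab := summable_mul_of_summable_norm (hsn a) (hsn b)
    refine Eq.trans ?_ ((hsn a).of_norm.tsum_mul_tsum_eq_tsum_sum_antidiagonal
      (hsn b).of_norm hab).symm
    refine tsum_congr fun m => ?_
    rw [QSeries.coeff_mul, Finset.sum_mul]
    refine Finset.sum_congr rfl fun p hp => ?_
    rw [Finset.HasAntidiagonal.mem_antidiagonal] at hp
    subst hp
    simp only [inv_one, Units.val_one, one_pow, one_mul, Finsupp.add_apply, pow_add,
      Finset.prod_mul_distrib]
    ring
  refine ⟨AlgHom.ofLinearMap f hone hmul, ?_, fun a => rfl⟩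
  refine continuous_of_norm_le (ρ := ρ) (C := 1) f fun a => ?_
  rw [one_mul]
  exact tsum_of_norm_bounded (a.2 ρ.1 ρ.2.1 ρ.2.2).hasSum (norm_eval_term_le hζρ a)

theorem eval_holMonomial {r : ℝ≥0∞} (ζ : Fin n → ℂ) (k : Fin n →₀ ℕ) :
    QSeries.eval ζ ((polydiskWeight 1 n).holMonomial r k : QSeries 1 n) = ∏ i, ζ i ^ k i := by
  rw [QSeries.eval, tsum_eq_single k]
  · simp [QSeries.monomial]
  · intro l hl
    simp [QSeries.monomial, hl]

theorem prod_pow_single (ζ : Fin n → ℂ) (s : Fin n) (m : ℕ) :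
    ∏ i, ζ i ^ Finsupp.single s m i = ζ s ^ m := by
  rw [Finset.prod_eq_single s]
  · simp
  · intro i _ hi
    simp [hi]
  · simp

/-- Values along a holomorphic curve in the polydisk depend holomorphically on the parameter. -/
theorem differentiableAt_eval {R : ℝ} {ζ : ℂ → Fin n → ℂ} (hd : Differentiable ℂ ζ) {z : ℂ}
    (hz : ‖ζ z‖ < R) (a : QPolydisk 1 n (ENNReal.ofReal R)) :
    DifferentiableAt ℂ (fun z => QSeries.eval (ζ z) (a : QSeries 1 n)) z := by
  obtain ⟨ρ, hρ⟩ := exists_radius_eq (R := R) (ρ := (‖ζ z‖ + R) / 2)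
    (by linarith [norm_nonneg (ζ z)]) (by linarith)
  have hU : IsOpen {z | ‖ζ z‖ < ρ.1} := isOpen_lt hd.continuous.norm continuous_const
  have hzU : z ∈ {z | ‖ζ z‖ < ρ.1} := by
    change ‖ζ z‖ < ρ.1
    linarith
  refine DifferentiableOn.differentiableAt (s := {z | ‖ζ z‖ < ρ.1}) ?_ (hU.mem_nhds hzU)
  refine Complex.differentiableOn_tsum_of_summable_norm (a.2 ρ.1 ρ.2.1 ρ.2.2) (fun k => ?_) hU
    fun k w hw => norm_eval_term_le (le_of_lt hw) a k
  have hdi : ∀ i, Differentiable ℂ fun z => ζ z i := differentiable_pi.1 hd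
  exact Differentiable.differentiableOn (by fun_prop)

/-! ### Characters of the ball algebra -/

theorem map_holMonomial_eq_prod {w : QWeight 1 n} {r : ℝ≥0∞} (χ : w.holAlg r →ₐ[ℂ] ℂ)
    (k : Fin n →₀ ℕ) : χ (w.holMonomial r k) = ∏ i, χ (w.holX r i) ^ k i := by
  refine Finsupp.induction_linear k ?_ (fun k l hk hl => ?_) fun i m => ?_
  · simp [holMonomial_zero]
  · rw [holMonomial_add, map_smul, map_mul, hk, hl]
    simp [pow_add, Finset.prod_mul_distrib]
  · rw [← holX_pow, map_pow, prod_pow_single (fun i => χ (w.holX r i))]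

/-- Links the weight to the Euclidean ball: by the multinomial theorem, inverse squared weights are
the coefficients of `(∑ |ζ_i|²)^m`. -/
theorem ballWeight_sq_mul_multinomial (k : Fin n →₀ ℕ) :
    (ballWeight 1 n).toFun k ^ 2 * Nat.multinomial Finset.univ k = 1 := by
  have h : ((∏ i, ((k i).factorial : ℝ)) * Nat.multinomial Finset.univ k) =
      ((∑ i, k i).factorial : ℝ) := by
    exact_mod_cast Nat.multinomial_spec Finset.univ k
  rw [ballWeight_of_norm_eq_one (by simp), Real.sq_sqrt (by positivity), div_mul_eq_mul_div, h,
    Finsupp.degree_eq_sum, div_self]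
  exact_mod_cast Nat.factorial_ne_zero _

theorem card_piAntidiag_le (n m : ℕ) :
    ((Finset.univ : Finset (Fin n)).piAntidiag m).card ≤ (m + 1) ^ n := by
  have h : (Finset.univ : Finset (Fin n)).piAntidiag m ⊆
      Fintype.piFinset fun _ => Finset.range (m + 1) := by
    intro k hk
    rw [Finset.mem_piAntidiag] at hk
    rw [Fintype.mem_piFinset]
    intro i
    rw [Finset.mem_range, ← hk.1]
    exact Nat.lt_succ_of_le (Finset.single_le_sum (fun _ _ => Nat.zero_le _) (Finset.mem_univ i))
  simpa using Finset.card_le_card h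

/-- The point of a continuous character of the ball algebra lies in a smaller ball. -/
theorem exists_sum_norm_sq_le {r : ℝ≥0∞} (hr : 0 < r) (χ : QBall 1 n r →ₐ[ℂ] ℂ)
    (hχ : Continuous χ) : ∃ ρ : {ρ : ℝ // 0 < ρ ∧ ENNReal.ofReal ρ < r},
      ∑ i, ‖χ ((ballWeight 1 n).holX r i)‖ ^ 2 ≤ ρ.1 ^ 2 := by
  obtain ⟨ρ, C, -, hC⟩ := exists_bound_seminorm hr ((normSeminorm ℂ ℂ).comp χ.toLinearMap) hχ.norm
  refine ⟨ρ, le_of_forall_pow_le (C := C ^ 2) (pow_pos ρ.2.1 2) n fun m => ?_⟩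
  rw [Finset.sum_pow_eq_sum_piAntidiag]
  -- Each term of the multinomial expansion of `(∑ |χ(x_i)|²)^m` is bounded separately by continuity
  -- of `χ` at `x^k`. There are at most `(m + 1)^n` terms, a polynomial factor harmless for the
  -- exponential rate.
  have hterm : ∀ k ∈ (Finset.univ : Finset (Fin n)).piAntidiag m,
      (Nat.multinomial Finset.univ k : ℝ) *
        ∏ i, (‖χ ((ballWeight 1 n).holX r i)‖ ^ 2) ^ k i ≤ C ^ 2 * (ρ.1 ^ 2) ^ m := by
    intro k hk
    obtain ⟨k, rfl⟩ := Finsupp.equivFunOnFinite.surjective k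
    rw [Finset.mem_piAntidiag] at hk
    have hdeg : k.degree = m := by
      rw [Finsupp.degree_eq_sum]
      exact hk.1
    have h1 : ‖χ ((ballWeight 1 n).holMonomial r k)‖ ≤ C * _ := hC _
    rw [holNorm_holMonomial, map_holMonomial_eq_prod, hdeg, norm_prod] at h1
    have h2 := pow_le_pow_left₀ (by positivity) h1 2
    rw [← Finset.prod_pow] at h2
    have e : ∏ i, (‖χ ((ballWeight 1 n).holX r i)‖ ^ 2) ^ k i =
        ∏ i, ‖χ ((ballWeight 1 n).holX r i) ^ k i‖ ^ 2 :=
      Finset.prod_congr rfl fun i _ => by rw [norm_pow]; ring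
    change (Nat.multinomial Finset.univ k : ℝ) *
      ∏ i, (‖χ ((ballWeight 1 n).holX r i)‖ ^ 2) ^ k i ≤ _
    rw [e]
    calc _ ≤ (Nat.multinomial Finset.univ k : ℝ) *
          (C * ((ballWeight 1 n).toFun k * ρ.1 ^ m)) ^ 2 := by gcongr
      _ = C ^ 2 * (ρ.1 ^ 2) ^ m *
          ((ballWeight 1 n).toFun k ^ 2 * Nat.multinomial Finset.univ k) := by ring
      _ = _ := by rw [ballWeight_sq_mul_multinomial, mul_one]
  refine (Finset.sum_le_card_nsmul _ _ _ hterm).trans ?_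
  have h3 : (((Finset.univ : Finset (Fin n)).piAntidiag m).card : ℝ) ≤ (m + 1 : ℝ) ^ n := by
    exact_mod_cast card_piAntidiag_le n m
  rw [nsmul_eq_mul]
  calc _ ≤ (m + 1 : ℝ) ^ n * (C ^ 2 * (ρ.1 ^ 2) ^ m) := by gcongr
    _ = _ := by ring

/-- A continuous character at a point of the ball of radius `ρ` is bounded by `‖·‖_ρ`. -/
theorem norm_character_le {r : ℝ≥0∞} (hr : 0 < r) (χ : QBall 1 n r →ₐ[ℂ] ℂ) (hχ : Continuous χ)
    (ρ : {ρ : ℝ // 0 < ρ ∧ ENNReal.ofReal ρ < r})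
    (h : ∑ i, ‖χ ((ballWeight 1 n).holX r i)‖ ^ 2 ≤ ρ.1 ^ 2) (a : QBall 1 n r) :
    ‖χ a‖ ≤ (ballWeight 1 n).holNorm r ρ a := by
  refine norm_le_of_norm_holMonomial_le hr χ.toLinearMap hχ ρ (fun k => ?_) a
  change ‖χ ((ballWeight 1 n).holMonomial r k)‖ ≤ _
  have hw := ballWeight_pos 1 k
  have hρ := ρ.2.1
  rw [map_holMonomial_eq_prod, norm_prod]
  refine le_of_sq_le_sq ?_ (by positivity)
  -- A single term of the multinomial expansion is at most the whole sum.
  have h1 : (Nat.multinomial Finset.univ k : ℝ) *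
      ∏ i, (‖χ ((ballWeight 1 n).holX r i)‖ ^ 2) ^ k i ≤
        (∑ i, ‖χ ((ballWeight 1 n).holX r i)‖ ^ 2) ^ k.degree := by
    rw [Finset.sum_pow_eq_sum_piAntidiag]
    refine Finset.single_le_sum (f := fun k : Fin n → ℕ => (Nat.multinomial Finset.univ k : ℝ) *
      ∏ i, (‖χ ((ballWeight 1 n).holX r i)‖ ^ 2) ^ k i) (fun k _ => by positivity) ?_
    rw [Finset.mem_piAntidiag, Finsupp.degree_eq_sum]
    exact ⟨rfl, fun i _ => Finset.mem_univ i⟩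
  have e : (∏ i, ‖χ ((ballWeight 1 n).holX r i) ^ k i‖) ^ 2 =
      ∏ i, (‖χ ((ballWeight 1 n).holX r i)‖ ^ 2) ^ k i := by
    rw [← Finset.prod_pow]
    exact Finset.prod_congr rfl fun i _ => by rw [norm_pow]; ring
  rw [e]
  calc _ = (ballWeight 1 n).toFun k ^ 2 * ((Nat.multinomial Finset.univ k : ℝ) *
        ∏ i, (‖χ ((ballWeight 1 n).holX r i)‖ ^ 2) ^ k i) := by
        rw [← mul_assoc, ballWeight_sq_mul_multinomial, one_mul]
    _ ≤ (ballWeight 1 n).toFun k ^ 2 * (ρ.1 ^ 2) ^ k.degree := by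
        gcongr
        exact h1.trans (pow_le_pow_left₀ (by positivity) h _)
    _ = _ := by ring

/-- A Schwarz-type estimate: a holomorphic map into a ball varies little if its value at the
centre is close to the sphere. -/
theorem norm_sub_sq_le_of_norm_le {E : Type*} [NormedAddCommGroup E] [InnerProductSpace ℂ E]
    {h : ℂ → E} {R N : ℝ} (hR : 0 < R) (hd : DifferentiableOn ℂ h (Metric.ball 0 R))
    (hN : ∀ w ∈ Metric.ball 0 R, ‖h w‖ ≤ N) (h0 : ‖h 0‖ < N) {w : ℂ} (hw : ‖w‖ ≤ R / 2) :
    ‖h w - h 0‖ ^ 2 ≤ 3 * (N ^ 2 - ‖h 0‖ ^ 2) := by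
  have hwR : w ∈ Metric.ball 0 R := by
    rw [mem_ball_zero_iff]
    linarith
  have hM : 0 < N ^ 2 - ‖h 0‖ ^ 2 := sub_pos.2 (pow_lt_pow_left₀ h0 (norm_nonneg _) two_ne_zero)
  -- Chosen so that `‖h w - h 0‖² = ‖h w‖² - ‖h 0‖² - Re (f w)`. Thus `f 0 = 0` and `Re f ≤ M` with
  -- `M = N² - ‖h 0‖²`; Borel–Carathéodory gives `|f| ≤ 2 M` on the half disk, and the total is `3
  -- M`.
  let f : ℂ → ℂ := fun w => 2 * (inner ℂ (h 0) (h w) - inner ℂ (h 0) (h 0))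
  have hre : ∀ w, (f w).re = 2 * (inner ℂ (h 0) (h w)).re - 2 * ‖h 0‖ ^ 2 := by
    intro w
    have h1 : (inner ℂ (h 0) (h 0)).re = ‖h 0‖ ^ 2 := inner_self_eq_norm_sq (𝕜 := ℂ) (h 0)
    rw [← h1]
    change (2 * (_ - _) : ℂ).re = _
    rw [Complex.mul_re, Complex.sub_re, Complex.re_ofNat, Complex.im_ofNat]
    ring
  have hexp : ∀ w, ‖h w - h 0‖ ^ 2 =
      ‖h w‖ ^ 2 - 2 * (inner ℂ (h 0) (h w)).re + ‖h 0‖ ^ 2 := by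
    intro w
    rw [norm_sub_rev, norm_sub_sq (𝕜 := ℂ)]
    simp only [RCLike.re_to_complex]
    ring
  have hfd : DifferentiableOn ℂ f (Metric.ball 0 R) :=
    (((innerSL ℂ (h 0)).differentiable.comp_differentiableOn hd).sub_const _).const_mul 2
  have hmaps : Set.MapsTo f (Metric.ball 0 R) {z | z.re ≤ N ^ 2 - ‖h 0‖ ^ 2} := by
    intro w hw
    have h1 := hexp w
    have h2 := pow_le_pow_left₀ (norm_nonneg _) (hN w hw) 2
    have h3 := sq_nonneg ‖h w - h 0‖
    change (f w).re ≤ _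
    rw [hre]
    linarith
  have hb := Complex.borelCaratheodory_zero hM hfd hmaps hR hwR (by simp [f])
  have hb2 : ‖f w‖ ≤ 2 * (N ^ 2 - ‖h 0‖ ^ 2) := by
    refine hb.trans ?_
    rw [div_le_iff₀ (by linarith)]
    gcongr
    linarith
  have h1 := (neg_le_abs _).trans ((Complex.abs_re_le_norm (f w)).trans hb2)
  have h2 := pow_le_pow_left₀ (norm_nonneg _) (hN w hwR) 2
  rw [hre] at h1
  rw [hexp]
  linarith

/-! ### The induced holomorphic map from polydisk to ball -/

/-- The map of polydisks and balls induced by a hom of the algebras. -/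
noncomputable def inducedMap {r : ℝ≥0∞} (ψ : QBall 1 n r ≃A[ℂ] QPolydisk 1 n r) (ζ : Fin n → ℂ) :
    EuclideanSpace ℂ (Fin n) :=
  WithLp.toLp 2 fun i => QSeries.eval ζ (ψ ((ballWeight 1 n).holX r i) : QSeries 1 n)

section induced

variable {R : ℝ} (ψ : QBall 1 n (ENNReal.ofReal R) ≃A[ℂ] QPolydisk 1 n (ENNReal.ofReal R))

theorem norm_inducedMap_sq (ζ : Fin n → ℂ) : ‖inducedMap ψ ζ‖ ^ 2 =
    ∑ i, ‖QSeries.eval ζ (ψ ((ballWeight 1 n).holX _ i) : QSeries 1 n)‖ ^ 2 := by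
  rw [EuclideanSpace.norm_sq_eq]
  rfl

/-- The coordinates of the image are the values at the generators of the continuous character
"evaluate at `ζ` after `ψ`" of the ball algebra. -/
theorem norm_inducedMap_lt (hR : 0 < R) {ζ : Fin n → ℂ} (hζ : ‖ζ‖ < R) :
    ‖inducedMap ψ ζ‖ < R := by
  obtain ⟨e, he, hev⟩ := exists_algHom_eval hζ
  obtain ⟨ρ, hρ⟩ := exists_sum_norm_sq_le (ENNReal.ofReal_pos.2 hR)
    (e.comp (ψ : QBall 1 n (ENNReal.ofReal R) →ₐ[ℂ] QPolydisk 1 n (ENNReal.ofReal R)))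
    (he.comp ψ.continuous)
  have h1 : ‖inducedMap ψ ζ‖ ^ 2 ≤ ρ.1 ^ 2 := by
    rw [norm_inducedMap_sq]
    refine le_trans (le_of_eq ?_) hρ
    exact Finset.sum_congr rfl fun i _ => by rw [← hev]; rfl
  exact (le_of_sq_le_sq h1 ρ.2.1.le).trans_lt (radius_lt hR ρ)

/-- The induced map is proper. -/
theorem exists_norm_le_of_norm_inducedMap_le (hR : 0 < R) {ρ : ℝ} (h0 : 0 < ρ) (hρ : ρ < R) :
    ∃ τ : ℝ, 0 < τ ∧ τ < R ∧ ∀ ζ : Fin n → ℂ, ‖ζ‖ < R → ‖inducedMap ψ ζ‖ ≤ ρ →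
      ∀ s, ‖ζ s‖ ≤ τ := by
  obtain ⟨ρ, rfl⟩ := exists_radius_eq h0 hρ
  have hr := ENNReal.ofReal_pos.2 hR
  obtain ⟨τ, C, -, hC⟩ := exists_bound hr ψ.symm.toLinearMap ψ.symm.continuous ρ
  refine ⟨τ.1, τ.2.1, radius_lt hR τ, fun ζ hζ hle s => ?_⟩
  obtain ⟨e, he, hev⟩ := exists_algHom_eval hζ
  -- The character sends `ψ.symm (x_s^m)` to `ζ_s^m`, so `|ζ_s|^m ≤ C τ^m` for all `m`. Here `C` and
  -- `τ` depend only on `ρ`, not on `ζ`.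
  refine le_of_forall_pow_le (C := C) τ.2.1 0 fun m => ?_
  have h1 := norm_character_le hr
    (e.comp (ψ : QBall 1 n (ENNReal.ofReal R) →ₐ[ℂ] QPolydisk 1 n (ENNReal.ofReal R)))
    (he.comp ψ.continuous) ρ (by
      refine le_trans (le_of_eq ?_) (pow_le_pow_left₀ (norm_nonneg _) hle 2)
      rw [norm_inducedMap_sq]
      exact Finset.sum_congr rfl fun i _ => by rw [← hev]; rfl)
    (ψ.symm ((polydiskWeight 1 n).holMonomial _ (Finsupp.single s m)))
  have h2 := h1.trans (hC _)
  have h3 : (e.comp (ψ : QBall 1 n (ENNReal.ofReal R) →ₐ[ℂ] QPolydisk 1 n (ENNReal.ofReal R)))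
      (ψ.symm ((polydiskWeight 1 n).holMonomial _ (Finsupp.single s m))) = ζ s ^ m := by
    change e (ψ (ψ.symm _)) = _
    rw [ContinuousAlgEquiv.apply_symm_apply, hev, eval_holMonomial, prod_pow_single]
  rw [h3, norm_pow, holNorm_holMonomial, polydiskWeight_of_norm_eq_one (by simp), one_mul,
    Finsupp.degree_single] at h2
  rwa [pow_zero, mul_one]

/-- The induced map is injective. -/
theorem eq_of_inducedMap_eq (hR : 0 < R) {ζ ζ' : Fin n → ℂ} (hζ : ‖ζ‖ < R) (hζ' : ‖ζ'‖ < R)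
    (h : inducedMap ψ ζ = inducedMap ψ ζ') : ζ = ζ' := by
  obtain ⟨e, he, hev⟩ := exists_algHom_eval hζ
  obtain ⟨e', he', hev'⟩ := exists_algHom_eval hζ'
  let ψ' : QBall 1 n (ENNReal.ofReal R) →ₐ[ℂ] QPolydisk 1 n (ENNReal.ofReal R) := ψ
  have hX : ∀ i, e (ψ ((ballWeight 1 n).holX _ i)) = e' (ψ ((ballWeight 1 n).holX _ i)) := by
    intro i
    rw [hev, hev']
    exact congrArg (fun v : EuclideanSpace ℂ (Fin n) => v i) h
  have heq : (e.comp ψ').toLinearMap = (e'.comp ψ').toLinearMap := by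
    refine eq_of_eq_on_holMonomial (ENNReal.ofReal_pos.2 hR) _ _ (he.comp ψ.continuous)
      (he'.comp ψ.continuous) fun k => ?_
    change (e.comp ψ') _ = (e'.comp ψ') _
    rw [map_holMonomial_eq_prod, map_holMonomial_eq_prod]
    exact Finset.prod_congr rfl fun i _ => congrArg (· ^ k i) (hX i)
  funext s
  have h1 := LinearMap.congr_fun heq (ψ.symm ((polydiskWeight 1 n).holX _ s))
  change e (ψ (ψ.symm _)) = e' (ψ (ψ.symm _)) at h1
  rw [ContinuousAlgEquiv.apply_symm_apply, hev, hev', eval_holMonomial, eval_holMonomial,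
    prod_pow_single, prod_pow_single, pow_one, pow_one] at h1
  exact h1

theorem differentiableAt_inducedMap {ζ : ℂ → Fin n → ℂ} (hd : Differentiable ℂ ζ) {z : ℂ}
    (hz : ‖ζ z‖ < R) : DifferentiableAt ℂ (fun z => inducedMap ψ (ζ z)) z := by
  rw [differentiableAt_euclidean]
  exact fun i => differentiableAt_eval hd hz _

end induced

/-- There is no biholomorphic map between the polydisk and the ball. -/
theorem isEmpty_equiv_of_eq_one (hn : 2 ≤ n) {R : ℝ} (hR : 0 < R) :
    IsEmpty (QPolydisk 1 n (ENNReal.ofReal R) ≃A[ℂ] QBall 1 n (ENNReal.ofReal R)) := by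
  refine ⟨fun φ => ?_⟩
  let ψ := φ.symm
  let s : Fin n := ⟨0, by omega⟩
  let t : Fin n := ⟨1, by omega⟩
  have hst : s ≠ t := by simp [s, t]
  let P : ℂ → ℂ → Fin n → ℂ := fun z w => Pi.single s z + Pi.single t w
  have hPs : ∀ z w, P z w s = z := fun z w => by simp [P, hst]
  have hPt : ∀ z w, P z w t = w := fun z w => by simp [P, hst.symm]
  have hP : ∀ z w, ‖z‖ < R → ‖w‖ < R → ‖P z w‖ < R := by
    intro z w hz hw
    rw [pi_norm_lt_iff hR]
    intro i
    by_cases his : i = s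
    · rwa [his, hPs]
    by_cases hit : i = t
    · rwa [hit, hPt]
    simpa [P, his, hit] using hR
  have hdz : ∀ w, Differentiable ℂ fun z => P z w := fun w => by
    rw [differentiable_pi]
    intro i
    simp only [P, Pi.add_apply, Pi.single_apply]
    split_ifs <;> fun_prop
  have hdw : ∀ z, Differentiable ℂ fun w => P z w := fun z => by
    rw [differentiable_pi]
    intro i
    simp only [P, Pi.add_apply, Pi.single_apply]
    split_ifs <;> fun_prop
  let w₀ : ℂ := ((R / 2 : ℝ) : ℂ)
  have hw₀ : ‖w₀‖ = R / 2 := by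
    rw [Complex.norm_real, Real.norm_eq_abs, abs_of_pos (by linarith)]
  have hw₀R : ‖w₀‖ < R := by linarith
  have h0R : ‖(0 : ℂ)‖ < R := by simpa using hR
  -- On the bidisk of the coordinates `s` and `t`, `g` is the increment of the induced map from `w =
  -- 0` to `w = R / 2`, as a function of `z`.
  let g : ℂ → EuclideanSpace ℂ (Fin n) := fun z => inducedMap ψ (P z w₀) - inducedMap ψ (P z 0)
  have hgd : ∀ z, ‖z‖ < R → DifferentiableAt ℂ g z := fun z hz =>
    (differentiableAt_inducedMap ψ (hdz w₀) (hP z w₀ hz hw₀R)).sub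
      (differentiableAt_inducedMap ψ (hdz 0) (hP z 0 hz h0R))
  have hg : ∀ z, ‖z‖ < R → ‖g z‖ ^ 2 ≤ 3 * (R ^ 2 - ‖inducedMap ψ (P z 0)‖ ^ 2) := by
    intro z hz
    refine norm_sub_sq_le_of_norm_le (h := fun w => inducedMap ψ (P z w)) hR ?_ ?_ ?_ hw₀.le
    · intro w hw
      exact (differentiableAt_inducedMap ψ (hdw z)
        (hP z w hz (mem_ball_zero_iff.1 hw))).differentiableWithinAt
    · intro w hw
      exact (norm_inducedMap_lt ψ hR (hP z w hz (mem_ball_zero_iff.1 hw))).le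
    · exact norm_inducedMap_lt ψ hR (hP z 0 hz h0R)
  have hsmall : ∀ ε : ℝ, 0 < ε → ‖g 0‖ ≤ ε := by
    intro ε hε
    obtain ⟨ρ, hρ0, hρR, hρ⟩ : ∃ ρ, 0 < ρ ∧ ρ < R ∧ 3 * (R ^ 2 - ρ ^ 2) < ε ^ 2 := by
      have hc : Filter.Tendsto (fun ρ : ℝ => 3 * (R ^ 2 - ρ ^ 2)) (nhdsWithin R (Set.Iio R))
          (nhds (3 * (R ^ 2 - R ^ 2))) := by
        refine Filter.Tendsto.mono_left (Continuous.tendsto ?_ R) nhdsWithin_le_nhds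
        fun_prop
      rw [sub_self, mul_zero] at hc
      have h1 := hc.eventually (gt_mem_nhds (pow_pos hε 2))
      have h2 : ∀ᶠ ρ in nhdsWithin R (Set.Iio R), ρ ∈ Set.Ioo 0 R := Ioo_mem_nhdsLT hR
      obtain ⟨ρ, h3, h4⟩ := (h1.and h2).exists
      exact ⟨ρ, h4.1, h4.2, h3⟩
    -- By properness `‖inducedMap ψ (P z 0)‖ > ρ` once `|z| > τ`, so `‖g‖ ≤ ε` on the circle of
    -- radius `(τ + R) / 2`; the maximum principle carries the bound to 0.
    obtain ⟨τ, hτ0, hτR, hτ⟩ := exists_norm_le_of_norm_inducedMap_le ψ hR hρ0 hρR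
    have hR' : (τ + R) / 2 < R := by linarith
    have hne : (τ + R) / 2 ≠ 0 := by linarith
    refine Complex.norm_le_of_forall_mem_frontier_norm_le (f := g)
      (U := Metric.ball (0 : ℂ) ((τ + R) / 2)) Metric.isBounded_ball ?_ ?_ ?_
    · refine DifferentiableOn.diffContOnCl fun z hz => ?_
      rw [closure_ball _ hne, mem_closedBall_zero_iff] at hz
      exact (hgd z (hz.trans_lt hR')).differentiableWithinAt
    · intro z hz
      rw [frontier_ball _ hne, mem_sphere_zero_iff_norm] at hz
      have hzR : ‖z‖ < R := hz.trans_lt hR'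
      have h1 : ρ < ‖inducedMap ψ (P z 0)‖ := by
        by_contra! hle
        have := hτ _ (hP z 0 hzR h0R) hle s
        rw [hPs] at this
        linarith
      have h2 := pow_le_pow_left₀ hρ0.le h1.le 2
      exact le_of_sq_le_sq (by linarith [hg z hzR]) hε.le
    · exact subset_closure (Metric.mem_ball_self (by linarith))
  have hg0 : g 0 = 0 := norm_le_zero_iff.1 (le_of_forall_pos_le_add fun ε hε => by
    simpa using hsmall ε hε)
  have h1 := eq_of_inducedMap_eq ψ hR (hP 0 w₀ h0R hw₀R) (hP 0 0 h0R h0R) (sub_eq_zero.1 hg0)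
  have h2 := congrFun h1 t
  rw [hPt, hPt] at h2
  rw [h2, norm_zero] at hw₀
  linarith

end commutative

theorem mainTheorem1 (n : ℕ) (q : ℂˣ) (r : ℝ≥0∞) (hr : 0 < r) :
    (2 ≤ n → r < ∞ → ‖(q : ℂ)‖ = 1 → IsEmpty (QPolydisk q n r ≃A[ℂ] QBall q n r)) ∧
    (‖(q : ℂ)‖ ≠ 1 →
      QPolydisk q n r = QBall q n r ∧
      ∃ φ : QPolydisk q n r ≃A[ℂ] QBall q n r,
        ∀ a : QPolydisk q n r, (φ a : QSeries q n) = (a : QSeries q n)) := by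
  refine ⟨fun hn hr' hq => ?_, polydisk_eq_ball n q r⟩
  have hR : 0 < r.toReal := ENNReal.toReal_pos hr.ne' hr'.ne
  rw [← ENNReal.ofReal_toReal hr'.ne]
  -- The rigidity argument needs a commutation constant different from 1, so the commutative case is
  -- handled by function theory.
  by_cases hq1 : (q : ℂ) = 1
  · obtain rfl : q = 1 := Units.ext hq1
    exact isEmpty_equiv_of_eq_one hn hR
  · exact isEmpty_equiv_of_ne_one hn hq hq1 hR
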